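/- Let $\Gamma\subset\mathbb C$ be the unit circle and let $\gamma(t):=r(t)e^{i\omega(t)}$ ($t\in\mathbb R$), where $r(t)=1-\frac1{2t}$ for $t\ge 1$, $r(t)=\frac{e^{t-1}}2$ for $t\le 1$, and $\omega$ is given, with $k$ ranging over the positive integers, by $$ \omega(t)=\begin{cases} -2k\pi-\frac{\pi}{2k^2+2-t} & \text{if } 2k^2-k+2\le t\le 2k^2+1,\\ -(2k+2)\pi+\frac{\pi}{t-2k^2} & \text{if } 2k^2+1\le t\le 2k^2+k+1,\\ -2k\pi+\frac{2k^2-2k+2-t}{k^2}\pi & \text{if } 2k^2-3k+2\le t\le 2k^2-k+2,\\ -4\pi+\frac{\pi}{t-2} & \text{if } 3\le t\le 4,\\ -t\pi & \text{if } t\le 3 \end{cases} $$ (the clauses agree where they overlap). Let $\mathfrak S:=\Gamma\cup\{\gamma(t):t\in\mathbb R\}$ with the topology of $\mathbb C$, and let $C_0(\mathfrak S\setminus\{1\})$ be the complex Banach space, with the supremum norm, of continuous functions $\mathfrak S\setminus\{1\}\to\mathbb C$ that vanish at infinity. A sequence $(x_n)_{n\ge1}$ in a Banach space is *weakly stable*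 if $x_n\to0$ weakly, and *almost weakly stable* if $x_{n_k}\to 0$ weakly for some strictly increasing sequence $(n_k)$ of positive integers of density $1$, that is, with $|\{k:n_k\le N\}|/N\to1$. A bounded operator $T$ on a Banach space is *almost weakly stable* if $(T^nx)_{n\ge1}$ is almost weakly stable for every vector $x$, and *almost weakly polynomial stable* if $(T^{p(n)}x)_{n\ge1}$ is almost weakly stable for every $x$ and every non-constant $p\in\mathbb Z[X]$ that maps positive integers to non-negative integers. Then there is a continuous flow $(\varphi_t)_{t\in\mathbb R}$ on $\mathfrak S$ with $\varphi_t(1)=1$, with $\varphi_t(\gamma(s))=\gamma(s+t)$, and with $\varphi_t(-1)=e^{\frac{\pi}{t+1}i}$ for $t\ge0$ and $\varphi_t(-1)=e^{\frac{\pi}{t-1}i}$ for $t\le0$. It leaves $\mathfrak S\setminus\{1\}$ invariant, and $T_0(t)f:=f\circ\varphi_t$ ($t\ge0$) defines a strongly continuous semigroup of isometries on $C_0(\mathfrak S\setminus\{1\})$ all of whose orbits $\{T_0(t)f:t\ge0\}$ are relatively weakly compact. Moreover: 1. $T_0(1)$ is a contraction (in fact an isometry), has no eigenvalue of modulus $1$,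 and is almost weakly stable. 2. Let $p(X)=2X^2-4X+3$. For every integer $n\ge1$ one has $\omega(p(n))=-(2n-1)\pi$, and $\gamma(p(n))\to-1$ as $n\to\infty$. Consequently, for every $f\in C_0(\mathfrak S\setminus\{1\})$, $$\lim_{n\to\infty}\langle T_0(1)^{p(n)}f,\delta_{\gamma(0)}\rangle=\lim_{n\to\infty}f(\gamma(p(n)))=f(-1).$$ 3. There are $f\in C_0(\mathfrak S\setminus\{1\})$ with $f(-1)\ne0$, and for each of them the sequence $(T_0(1)^{p(n)}f)_{n\ge1}$ is neither weakly stable nor almost weakly stable. Hence $T_0(1)$ is not almost weakly polynomial stable. In particular, it is not true that every almost weakly stable contraction on a Banach space is almost weakly polynomial stable. -/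

import Mathlib

open Filter Topology
open scoped ZeroAtInfty

/-! ### Weak stability, almost weak stability, polynomial variants -/

section Stability

variable {X : Type*} [NormedAddCommGroup X] [NormedSpace ℂ X]

/-- The strictly increasing sequence `(n k)` of natural numbers has density `d`:
`|{k | n k ≤ N}| / N → d`. -/
def HasSeqDensity (n : ℕ → ℕ) (d : ℝ) : Prop :=
  Tendsto (fun N : ℕ => (({k : ℕ | n k ≤ N}.ncard : ℕ) : ℝ) / (N : ℝ)) atTop (𝓝 d)

/-- The sequence `x` converges to `0` in the weak topology of `X`. -/
def WeaklyStableSeq (x : ℕ → X) : Prop :=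
  Tendsto (fun n => toWeakSpace ℂ X (x n)) atTop (𝓝 0)

/-- The sequence `x 1, x 2, …` converges weakly to `0` along some subsequence of density `1`.
(The value `x 0` plays no role.) -/
def AlmostWeaklyStableSeq (x : ℕ → X) : Prop :=
  ∃ n : ℕ → ℕ, StrictMono n ∧ (∀ k, 0 < n k) ∧ HasSeqDensity n 1 ∧
    WeaklyStableSeq (fun k => x (n k))

/-- Every orbit `(T ^ n x)` is almost weakly stable. -/
def AlmostWeaklyStable (T : X →L[ℂ] X) : Prop :=
  ∀ x : X, AlmostWeaklyStableSeq (fun n => (T ^ n) x)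

/-- Integer polynomials that map positive integers to nonnegative integers. -/
def MapsPosToNonneg (p : Polynomial ℤ) : Prop :=
  ∀ n : ℕ, 0 < n → 0 ≤ p.eval (n : ℤ)

/-- The sequence `n ↦ T ^ p(n)`, used for `p` with `MapsPosToNonneg p` and `n > 0`. -/
noncomputable def polyPow (T : X →L[ℂ] X) (p : Polynomial ℤ) (n : ℕ) : X →L[ℂ] X :=
  T ^ (p.eval (n : ℤ)).toNat

/-- For every vector `x` and every nonconstant integer polynomial `p` mapping positive integers
to nonnegative integers, the sequence `(T ^ p(n) x)` is almost weakly stable. -/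
def AlmostWeaklyPolynomialStable (T : X →L[ℂ] X) : Prop :=
  ∀ p : Polynomial ℤ, 0 < p.natDegree → MapsPosToNonneg p →
    ∀ x : X, AlmostWeaklyStableSeq (fun n => polyPow T p n x)

end Stability

/-! ### The Koopman group of a flow on `C₀` -/

section Koopman

variable {Y : Type*} [TopologicalSpace Y]

/-- The evaluation functional (Dirac measure) `δ_x` on `C₀(Y, ℂ)`. -/
noncomputable def diracFunctional (x : Y) : C₀(Y, ℂ) →L[ℂ] ℂ :=
  LinearMap.mkContinuous
    { toFun := fun f => f x
      map_add' := fun _ _ => rfl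
      map_smul' := fun _ _ => rfl } 1
    (fun f => by
      rw [one_mul]
      exact f.toBCF.norm_coe_le_norm x)

/-- The time-`t` map of a flow as a proper map. -/
def flowCocompact (φ : Flow ℝ Y) (t : ℝ) : CocompactMap Y Y :=
  (φ.toHomeomorph t).toCocompactMap

/-- The Koopman operator `f ↦ f ∘ φ_t` on `C₀(Y, ℂ)`. -/
noncomputable def koopman (φ : Flow ℝ Y) (t : ℝ) : C₀(Y, ℂ) →L[ℂ] C₀(Y, ℂ) :=
  LinearMap.mkContinuous
    { toFun := fun f => f.comp (flowCocompact φ t)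
      map_add' := fun _ _ => rfl
      map_smul' := fun _ _ => rfl } 1
    (fun f => by
      rw [one_mul]
      refine (BoundedContinuousFunction.norm_le (norm_nonneg _)).2 fun x => ?_
      exact f.toBCF.norm_coe_le_norm (φ t x))

theorem koopman_apply (φ : Flow ℝ Y) (t : ℝ) (f : C₀(Y, ℂ)) (x : Y) :
    koopman φ t f x = f (φ t x) := rfl

end Koopman

/-! ### The spiral, the set `𝔖` and the homoclinic parametrization of the circle -/

/-- The radius `r(t)` of the spiral. -/
noncomputable def spiralRadius (t : ℝ) : ℝ :=
  if 1 ≤ t then 1 - 1 / (2 * t) else Real.exp (t - 1) / 2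

/-- The number of the round around `0` that the spiral is on at time `t ≥ 1`: the largest integer
`k` with `2k² - 3k + 2 ≤ t`. -/
noncomputable def spiralRound (t : ℝ) : ℤ := ⌊(3 + √(8 * t - 7)) / 4⌋

/-- The angle `ω(t)` of the spiral; see `spiralAngle_spec` for the usual piecewise form. -/
noncomputable def spiralAngle (t : ℝ) : ℝ :=
  if t ≤ 3 then -t * Real.pi
  else
    let k : ℝ := (spiralRound t : ℝ)
    if t ≤ 2 * k ^ 2 - k + 2 then
      -2 * k * Real.pi + (2 * k ^ 2 - 2 * k + 2 - t) / k ^ 2 * Real.pi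
    else if t ≤ 2 * k ^ 2 + 1 then
      -2 * k * Real.pi - Real.pi / (2 * k ^ 2 + 2 - t)
    else
      -(2 * k + 2) * Real.pi + Real.pi / (t - 2 * k ^ 2)

theorem spiralRound_eq {t : ℝ} {k : ℤ} (hk : 1 ≤ k)
    (h₁ : 2 * (k : ℝ) ^ 2 - 3 * k + 2 ≤ t) (h₂ : t < 2 * (k : ℝ) ^ 2 + k + 1) :
    spiralRound t = k := by
  have hk' : (1 : ℝ) ≤ k := by exact_mod_cast hk
  unfold spiralRound
  rw [Int.floor_eq_iff]
  constructor
  · rw [le_div_iff₀ (by norm_num)]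
    have : 4 * (k : ℝ) - 3 ≤ √(8 * t - 7) := Real.le_sqrt_of_sq_le (by nlinarith)
    linarith
  · rw [div_lt_iff₀ (by norm_num)]
    have : √(8 * t - 7) < 4 * (k : ℝ) + 1 := by
      rw [Real.sqrt_lt' (by linarith)]
      nlinarith
    linarith

/-- The piecewise description that determines `ω`: the last two clauses give `ω` on `(-∞, 4]`, the
first three, for `k = 1, 2, …`, give it on `[1, ∞)`, and they agree on overlaps. -/
theorem spiralAngle_spec :
    (∀ k : ℤ, 1 ≤ k → ∀ t : ℝ, 2 * (k : ℝ) ^ 2 - k + 2 ≤ t → t ≤ 2 * (k : ℝ) ^ 2 + 1 →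
      spiralAngle t = -2 * k * Real.pi - Real.pi / (2 * (k : ℝ) ^ 2 + 2 - t)) ∧
    (∀ k : ℤ, 1 ≤ k → ∀ t : ℝ, 2 * (k : ℝ) ^ 2 + 1 ≤ t → t ≤ 2 * (k : ℝ) ^ 2 + k + 1 →
      spiralAngle t = -(2 * k + 2) * Real.pi + Real.pi / (t - 2 * (k : ℝ) ^ 2)) ∧
    (∀ k : ℤ, 1 ≤ k → ∀ t : ℝ, 2 * (k : ℝ) ^ 2 - 3 * k + 2 ≤ t → t ≤ 2 * (k : ℝ) ^ 2 - k + 2 →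
      spiralAngle t =
        -2 * k * Real.pi + (2 * (k : ℝ) ^ 2 - 2 * k + 2 - t) / (k : ℝ) ^ 2 * Real.pi) ∧
    (∀ t : ℝ, 3 ≤ t → t ≤ 4 → spiralAngle t = -4 * Real.pi + Real.pi / (t - 2)) ∧
    (∀ t : ℝ, t ≤ 3 → spiralAngle t = -t * Real.pi) := by
  have E : ∀ t : ℝ, t ≤ 3 → spiralAngle t = -t * Real.pi := fun t ht => by
    simp [spiralAngle, ht]
  have C : ∀ k : ℤ, 1 ≤ k → ∀ t : ℝ, 2 * (k : ℝ) ^ 2 - 3 * k + 2 ≤ t →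
      t ≤ 2 * (k : ℝ) ^ 2 - k + 2 → spiralAngle t =
        -2 * k * Real.pi + (2 * (k : ℝ) ^ 2 - 2 * k + 2 - t) / (k : ℝ) ^ 2 * Real.pi := by
    intro k hk t h₁ h₂
    have hk' : (1 : ℝ) ≤ k := by exact_mod_cast hk
    by_cases ht : t ≤ 3
    · have : k = 1 := by
        by_contra hne
        have h2 : (2 : ℝ) ≤ k := by exact_mod_cast (by omega : (2 : ℤ) ≤ k)
        nlinarith
      subst this
      rw [E t ht]
      push_cast
      ring
    · have hr : spiralRound t = k := spiralRound_eq hk h₁ (by linarith)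
      simp only [spiralAngle, ht, if_false, hr, h₂, if_true]
  have A : ∀ k : ℤ, 1 ≤ k → ∀ t : ℝ, 2 * (k : ℝ) ^ 2 - k + 2 ≤ t → t ≤ 2 * (k : ℝ) ^ 2 + 1 →
      spiralAngle t = -2 * k * Real.pi - Real.pi / (2 * (k : ℝ) ^ 2 + 2 - t) := by
    intro k hk t h₁ h₂
    have hk' : (1 : ℝ) ≤ k := by exact_mod_cast hk
    have hk0 : (k : ℝ) ≠ 0 := by linarith
    rcases h₁.eq_or_lt with h | h
    · rw [C k hk t (by linarith) h.ge, ← h]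
      have e₁ : 2 * (k : ℝ) ^ 2 + 2 - (2 * (k : ℝ) ^ 2 - k + 2) = k := by ring
      have e₂ : 2 * (k : ℝ) ^ 2 - 2 * k + 2 - (2 * (k : ℝ) ^ 2 - k + 2) = -k := by ring
      rw [e₁, e₂]
      field_simp
      ring
    · have hr : spiralRound t = k := spiralRound_eq hk (by linarith) (by linarith)
      have ht : ¬ t ≤ 3 := by nlinarith
      simp only [spiralAngle, ht, if_false, hr, not_le.2 h, h₂, if_true]
  have B : ∀ k : ℤ, 1 ≤ k → ∀ t : ℝ, 2 * (k : ℝ) ^ 2 + 1 ≤ t → t ≤ 2 * (k : ℝ) ^ 2 + k + 1 →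
      spiralAngle t = -(2 * k + 2) * Real.pi + Real.pi / (t - 2 * (k : ℝ) ^ 2) := by
    intro k hk t h₁ h₂
    have hk' : (1 : ℝ) ≤ k := by exact_mod_cast hk
    rcases h₁.eq_or_lt with h | h
    · rw [A k hk t (by linarith) h.ge, ← h]
      have e₁ : 2 * (k : ℝ) ^ 2 + 2 - (2 * (k : ℝ) ^ 2 + 1) = 1 := by ring
      have e₂ : 2 * (k : ℝ) ^ 2 + 1 - 2 * (k : ℝ) ^ 2 = 1 := by ring
      rw [e₁, e₂]
      ring
    · rcases h₂.eq_or_lt with h' | h'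
      · rw [C (k + 1) (by omega) t (by push_cast; nlinarith) (by push_cast; nlinarith), h']
        have hk1 : (k : ℝ) + 1 ≠ 0 := by linarith
        have e₁ : 2 * (k : ℝ) ^ 2 + k + 1 - 2 * (k : ℝ) ^ 2 = k + 1 := by ring
        rw [e₁]
        push_cast
        field_simp
        ring
      · have hr : spiralRound t = k := spiralRound_eq hk (by linarith) h'
        have ht : ¬ t ≤ 3 := by nlinarith
        have h3 : ¬ t ≤ 2 * (k : ℝ) ^ 2 - k + 2 := by linarith
        simp only [spiralAngle, ht, if_false, hr, h3, not_le.2 h]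
  refine ⟨A, B, C, fun t h₁ h₂ => ?_, E⟩
  have := B 1 le_rfl t (by push_cast; linarith) (by push_cast; linarith)
  rw [this]
  push_cast
  ring_nf

/-- The spiral `γ(t) = r(t) e^{i ω(t)}`. -/
noncomputable def spiral (t : ℝ) : ℂ :=
  (spiralRadius t : ℂ) * Complex.exp ((spiralAngle t : ℂ) * Complex.I)

/-- The set `𝔖`: the unit circle together with the spiral. -/
def spiralSet : Set ℂ := Metric.sphere (0 : ℂ) 1 ∪ Set.range spiral

/-- The point `1` of `𝔖`. -/
def fixPt : spiralSet := ⟨1, Or.inl (by simp)⟩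

/-- The point `-1` of `𝔖`. -/
def antiPt : spiralSet := ⟨-1, Or.inl (by simp)⟩

/-- The point `γ(t)` of `𝔖`. -/
noncomputable def spiralPt (t : ℝ) : spiralSet := ⟨spiral t, Or.inr ⟨t, rfl⟩⟩

/-- The orbit of `-1` under the flow, which runs through the circle without `1`. -/
noncomputable def homoclinic (t : ℝ) : ℂ :=
  if 0 ≤ t then Complex.exp ((Real.pi / (t + 1) : ℝ) * Complex.I)
  else Complex.exp ((Real.pi / (t - 1) : ℝ) * Complex.I)

/-- The space `𝔖 ∖ {1}`. -/
abbrev PuncturedSpiralSet : Type := ↥({fixPt}ᶜ : Set spiralSet)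

theorem spiral_norm_lt_one (t : ℝ) : ‖spiral t‖ < 1 := by
  have h : ‖spiral t‖ = |spiralRadius t| := by
    simp [spiral, Complex.norm_exp_ofReal_mul_I]
  rw [h, abs_lt, spiralRadius]
  split_ifs with ht
  · have h₁ : 0 < 1 / (2 * t) := by positivity
    have h₂ : 1 / (2 * t) ≤ 1 := by
      rw [div_le_one (by positivity)]
      linarith
    constructor <;> linarith
  · have h₁ := Real.exp_pos (t - 1)
    have h₂ : Real.exp (t - 1) < 1 := Real.exp_lt_one_iff.2 (by linarith)
    constructor <;> linarith

/-- The point `-1` of `𝔖 ∖ {1}`. -/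
noncomputable def antiPt' : PuncturedSpiralSet :=
  ⟨antiPt, fun h => by
    have h' : (-1 : ℂ) = 1 := congrArg Subtype.val (Set.mem_singleton_iff.1 h)
    norm_num at h'⟩

/-- The point `γ(t)` of `𝔖 ∖ {1}`. -/
noncomputable def spiralPt' (t : ℝ) : PuncturedSpiralSet :=
  ⟨spiralPt t, fun h => by
    have h' : spiral t = 1 := congrArg Subtype.val (Set.mem_singleton_iff.1 h)
    have := spiral_norm_lt_one t
    rw [h', norm_one] at this
    exact lt_irrefl _ this⟩

/-- The polynomial `2X² - 4X + 3`. -/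
noncomputable def examplePoly : Polynomial ℤ :=
  2 * Polynomial.X ^ 2 - 4 * Polynomial.X + 3

/-!
The flow on `𝔖` has three orbits: the fixed point `1`, the rest of the circle, which is homoclinic to
`1`, and the spiral. Round `k` of the spiral meets the negative real axis at time `2k² + 1`. During a
central part of that round, whose length grows with `k`, it turns exactly as the orbit `homoclinic`
of `-1` does, and for the remaining time it creeps past the direction `1`. Hence at a late time the
spiral follows, over any bounded time span, the circle flow started at `homoclinic v`, where `v` is
the time counted from the passage through the negative real axis (`tendsto_spiral_sub_homoclinic`).
This makes the flow jointly continuous at the circle (`continuousOn_spiralFlowFun`).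

For `f` in `C₀(𝔖 ∖ {1})`, the function `T₀(t) f` is therefore asymptotic, pointwise and hence weakly,
to the function `F_v` that vanishes on the circle and has the value `f (homoclinic (s + v))` at
`γ(s)`, with `v = spiralOffset t` (`tendsto_koopman_sub_orbitLimit`). Moreover `F_v` depends
continuously on `v` and tends weakly to `0` as `|v| → ∞` (`tendsto_orbitLimit_cocompact`). So the
orbit together with `0` and all `F_v` is weakly compact, and `T₀(n) f` tends weakly to `0` along the
integers `n` that keep a distance of at least about `n ^ (1/4)` from the time `2k² + 1` of their
round; these integers have density `1` (`tendsto_count_isFarTime`). Unimodular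
eigenvalues are incompatible with such a subsequence. On the other hand, at the times
`2n² - 4n + 3 = 2(n - 1)² + 1` the spiral meets the negative real axis, so along them the value of
`T₀(·) f` at `γ(0)` tends to `f(-1)`.

Weak convergence is obtained from bounded pointwise convergence
(`ZeroAtInftyContinuousMap.tendsto_toWeakSpace_zero`). For this it suffices to dominate a functional
`ξ` on `C₀(Y)` by a finite measure (`ZeroAtInftyContinuousMap.exists_measure_norm_le_integral`),
which the Riesz–Markov–Kakutani theorem provides for the total variation of `ξ`.
-/

/-! ### Bounded pointwise null families in `C₀` are weakly null -/

section WeakNull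

open MeasureTheory CompactlySupported
open scoped NNReal ENNReal

namespace ZeroAtInftyContinuousMap

variable {Y : Type*} [TopologicalSpace Y]

/-- A continuous function dominated by an element of `C₀` belongs to `C₀`. -/
def ofLE (g : C₀(Y, ℂ)) (f : Y → ℂ) (hf : Continuous f) (h : ∀ y, ‖f y‖ ≤ ‖g y‖) : C₀(Y, ℂ) where
  toFun := f
  continuous_toFun := hf
  zero_at_infty' := squeeze_zero_norm h (by simpa using (zero_at_infty g).norm)

theorem norm_le_of_forall {f : C₀(Y, ℂ)} {c : ℝ} (hc : 0 ≤ c) (h : ∀ y, ‖f y‖ ≤ c) : ‖f‖ ≤ c :=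
  (BoundedContinuousFunction.norm_le (f := f.toBCF) hc).2 h

theorem norm_apply_le (f : C₀(Y, ℂ)) (y : Y) : ‖f y‖ ≤ ‖f‖ :=
  f.toBCF.norm_coe_le_norm y

/-- The set where an element of `C₀` has modulus at least `ε > 0` is compact. -/
theorem isCompact_norm_ge (f : C₀(Y, ℂ)) {ε : ℝ} (hε : 0 < ε) : IsCompact {y | ε ≤ ‖f y‖} := by
  have h : ∀ᶠ y in cocompact Y, ‖f y‖ < ε := by
    simpa using (zero_at_infty f).norm.eventually (gt_mem_nhds (by simpa using hε))
  obtain ⟨K, hK, hKs⟩ := mem_cocompact.1 h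
  refine hK.of_isClosed_subset (isClosed_le continuous_const (by fun_prop)) fun y hy => ?_
  by_contra hyK
  exact absurd (show ‖f y‖ < ε from hKs hyK) (not_lt.2 hy)

/-- The functions `g ∈ C₀(Y)` with `|g| ≤ f`. -/
abbrev Dominated (f : C_c(Y, ℝ≥0)) : Type _ := {g : C₀(Y, ℂ) // ∀ y, ‖g y‖₊ ≤ f y}

instance (f : C_c(Y, ℝ≥0)) : Nonempty (Dominated f) := ⟨⟨0, fun y => by simp⟩⟩

variable (ξ : C₀(Y, ℂ) →L[ℂ] ℂ)

/-- The total variation `|ξ|` of a functional `ξ` on `C₀(Y)`, as a function on the nonnegative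
compactly supported functions: `|ξ|(f) = sup {‖ξ g‖ | |g| ≤ f}`. -/
noncomputable def variationAux (f : C_c(Y, ℝ≥0)) : ℝ≥0 := ⨆ g : Dominated f, ‖ξ g.1‖₊

variable {ξ}

theorem nnnorm_le_of_dominated {f : C_c(Y, ℝ≥0)} {c : ℝ≥0} (hc : ∀ y, f y ≤ c)
    (g : Dominated f) : ‖ξ g.1‖₊ ≤ ‖ξ‖₊ * c := by
  have h1 : ‖g.1‖₊ ≤ c := norm_le_of_forall c.2 fun y => by exact_mod_cast (g.2 y).trans (hc y)
  exact (ξ.le_opNNNorm g.1).trans (mul_le_mul_right h1 _)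

theorem variationAux_le {f : C_c(Y, ℝ≥0)} {c : ℝ≥0} (hc : ∀ y, f y ≤ c) :
    variationAux ξ f ≤ ‖ξ‖₊ * c :=
  ciSup_le fun g => nnnorm_le_of_dominated hc g

theorem nnnorm_le_variationAux {f : C_c(Y, ℝ≥0)} {g : C₀(Y, ℂ)} (hg : ∀ y, ‖g y‖₊ ≤ f y) :
    ‖ξ g‖₊ ≤ variationAux ξ f := by
  obtain ⟨C, hC⟩ := (f.hasCompactSupport.isCompact_range f.continuous).bddAbove
  refine le_ciSup (f := fun g : Dominated f => ‖ξ g.1‖₊) ⟨‖ξ‖₊ * C, ?_⟩ ⟨g, hg⟩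
  rintro _ ⟨g, rfl⟩
  exact nnnorm_le_of_dominated (fun y => hC ⟨y, rfl⟩) g

theorem mul_variationAux_le (c : ℝ≥0) (f : C_c(Y, ℝ≥0)) :
    c * variationAux ξ f ≤ variationAux ξ (c • f) := by
  refine NNReal.mul_iSup_le fun g => ?_
  have h : ∀ y, ‖(((c : ℝ) : ℂ) • g.1) y‖₊ ≤ (c • f) y := fun y => by
    have : ‖(((c : ℝ) : ℂ) • g.1) y‖₊ = c * ‖g.1 y‖₊ := by ext; simp
    rw [this]
    exact mul_le_mul_right (g.2 y) _
  refine le_trans (le_of_eq ?_) (nnnorm_le_variationAux h)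
  ext
  simp

theorem variationAux_smul (c : ℝ≥0) (f : C_c(Y, ℝ≥0)) :
    variationAux ξ (c • f) = c * variationAux ξ f := by
  refine le_antisymm ?_ (mul_variationAux_le c f)
  rcases eq_or_ne c 0 with rfl | hc
  · simpa using variationAux_le (ξ := ξ) (f := (0 : ℝ≥0) • f) (c := 0) (by simp)
  · have := mul_variationAux_le (ξ := ξ) c⁻¹ (c • f)
    rw [smul_smul, inv_mul_cancel₀ hc, one_smul] at this
    rwa [inv_mul_le_iff₀ (pos_iff_ne_zero.2 hc)] at this

theorem ciSup_add_ciSup_le_of_forall {ι κ : Type*} [Nonempty ι] [Nonempty κ] {a : ι → ℝ≥0}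
    {b : κ → ℝ≥0} {c : ℝ≥0} (h : ∀ i j, a i + b j ≤ c) : (⨆ i, a i) + ⨆ j, b j ≤ c := by
  have h₁ : ∀ j, (⨆ i, a i) + b j ≤ c := fun j =>
    (le_tsub_iff_right (le_add_self.trans (h (Classical.arbitrary ι) j))).1
      (ciSup_le fun i => le_tsub_of_add_le_right (h i j))
  exact (le_tsub_iff_left (le_self_add.trans (h₁ (Classical.arbitrary κ)))).1
    (ciSup_le fun j => le_tsub_of_add_le_left (h₁ j))

theorem add_variationAux_le (f₁ f₂ : C_c(Y, ℝ≥0)) :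
    variationAux ξ f₁ + variationAux ξ f₂ ≤ variationAux ξ (f₁ + f₂) := by
  refine ciSup_add_ciSup_le_of_forall fun g₁ g₂ => ?_
  -- rotate `g₁` and `g₂` so that `ξ` takes nonnegative real values on them
  obtain ⟨θ₁, hθ₁, e₁⟩ := Complex.exists_norm_eq_mul_self (ξ g₁.1)
  obtain ⟨θ₂, hθ₂, e₂⟩ := Complex.exists_norm_eq_mul_self (ξ g₂.1)
  have h : ∀ y, ‖(θ₁ • g₁.1 + θ₂ • g₂.1) y‖₊ ≤ (f₁ + f₂) y := fun y => by
    refine (nnnorm_add_le _ _).trans (add_le_add ?_ ?_)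
    · have : ‖(θ₁ • g₁.1) y‖₊ = ‖g₁.1 y‖₊ := by ext; simp [hθ₁]
      exact this.trans_le (g₁.2 y)
    · have : ‖(θ₂ • g₂.1) y‖₊ = ‖g₂.1 y‖₊ := by ext; simp [hθ₂]
      exact this.trans_le (g₂.2 y)
  refine le_trans (le_of_eq ?_) (nnnorm_le_variationAux h)
  ext
  rw [map_add, map_smul, map_smul, smul_eq_mul, smul_eq_mul, ← e₁, ← e₂, ← Complex.ofReal_add,
    coe_nnnorm, Complex.norm_real, Real.norm_of_nonneg (by positivity)]
  simp

/-- Multiplication by `a / (a + ε)` replaces a cutoff that would divide by a possibly vanishing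
`a`, at the cost of an error `ε`. -/
theorem norm_sub_mul_div_le {z : ℂ} {a ε : ℝ} (hε : 0 < ε) (ha : 0 ≤ a) (hz : ‖z‖ ≤ a + ε) :
    ‖z - z * ((a / (a + ε) : ℝ) : ℂ)‖ ≤ ε := by
  have h : z - z * ((a / (a + ε) : ℝ) : ℂ) = z * ((ε / (a + ε) : ℝ) : ℂ) := by
    have : ((a / (a + ε) : ℝ) : ℂ) = 1 - ((ε / (a + ε) : ℝ) : ℂ) := by
      rw [← Complex.ofReal_one, ← Complex.ofReal_sub]
      congr 1
      field_simp
      ring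
    rw [this]
    ring
  rw [h, norm_mul, Complex.norm_real, Real.norm_of_nonneg (by positivity), mul_div_assoc',
    div_le_iff₀ (by positivity), mul_comm]
  exact mul_le_mul_of_nonneg_left hz hε.le

theorem norm_mul_div_le {z : ℂ} {a b : ℝ} (hb : 0 < b) (ha : 0 ≤ a) (hz : ‖z‖ ≤ b) :
    ‖z * ((a / b : ℝ) : ℂ)‖ ≤ a := by
  rw [norm_mul, Complex.norm_real, Real.norm_of_nonneg (by positivity), mul_div_assoc',
    div_le_iff₀ hb, mul_comm]
  exact mul_le_mul_of_nonneg_left hz ha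

theorem variationAux_add_le (f₁ f₂ : C_c(Y, ℝ≥0)) :
    variationAux ξ (f₁ + f₂) ≤ variationAux ξ f₁ + variationAux ξ f₂ := by
  refine ciSup_le fun ⟨g, hg⟩ => ?_
  have hg' : ∀ y, ‖g y‖ ≤ f₁ y + f₂ y := fun y => by exact_mod_cast hg y
  rw [← NNReal.coe_le_coe]
  refine le_of_forall_pos_le_add fun ε hε => ?_
  obtain ⟨δ, hδ, hδε⟩ : ∃ δ > 0, ‖ξ‖ * δ ≤ ε :=
    ⟨ε / (‖ξ‖ + 1), by positivity, by
      rw [mul_div_assoc', div_le_iff₀ (by positivity)]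
      nlinarith [norm_nonneg ξ]⟩
  have hpos : ∀ y, (0 : ℝ) < f₁ y + f₂ y + δ := fun y => by positivity
  have hle : ∀ (f : C_c(Y, ℝ≥0)), (∀ y, (f y : ℝ) ≤ f₁ y + f₂ y) → ∃ g' : C₀(Y, ℂ),
      (∀ y, g' y = g y * (((f y : ℝ) / (f₁ y + f₂ y + δ) : ℝ) : ℂ)) ∧ ∀ y, ‖g' y‖₊ ≤ f y := by
    intro f hf
    refine ⟨ofLE g (fun y => g y * (((f y : ℝ) / (f₁ y + f₂ y + δ) : ℝ) : ℂ)) ?_ ?_,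
      fun y => rfl, fun y => ?_⟩
    · refine g.continuous.mul (Complex.continuous_ofReal.comp ?_)
      refine Continuous.div ?_ ?_ fun y => (hpos y).ne'
      · exact NNReal.continuous_coe.comp f.continuous
      · exact ((NNReal.continuous_coe.comp f₁.continuous).add
          (NNReal.continuous_coe.comp f₂.continuous)).add continuous_const
    · intro y
      rw [norm_mul]
      refine mul_le_of_le_one_right (norm_nonneg _) ?_
      rw [Complex.norm_real, Real.norm_of_nonneg (div_nonneg (f y).coe_nonneg (hpos y).le),
        div_le_one (hpos y)]
      linarith [hf y]
    · exact norm_mul_div_le (hpos y) (f y).2 ((hg' y).trans (by linarith))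
  obtain ⟨g₁, e₁, h₁⟩ := hle f₁ fun y => by simp
  obtain ⟨g₂, e₂, h₂⟩ := hle f₂ fun y => by simp
  have hs : ‖g - (g₁ + g₂)‖ ≤ δ := norm_le_of_forall hδ.le fun y => by
    have : (g - (g₁ + g₂)) y
        = g y - g y * (((f₁ y + f₂ y : ℝ) / (f₁ y + f₂ y + δ) : ℝ) : ℂ) := by
      simp only [sub_apply, add_apply, e₁, e₂]
      push_cast
      ring
    rw [this]
    exact norm_sub_mul_div_le hδ (by positivity) ((hg' y).trans (by linarith))
  have e : ξ g = ξ (g - (g₁ + g₂)) + ξ g₁ + ξ g₂ := by simp; ring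
  have b₁ : ‖ξ g₁‖ ≤ variationAux ξ f₁ := nnnorm_le_variationAux h₁
  have b₂ : ‖ξ g₂‖ ≤ variationAux ξ f₂ := nnnorm_le_variationAux h₂
  have b₃ : ‖ξ (g - (g₁ + g₂))‖ ≤ ‖ξ‖ * δ :=
    (ξ.le_opNorm _).trans (mul_le_mul_of_nonneg_left hs (norm_nonneg _))
  have := norm_add₃_le (a := ξ (g - (g₁ + g₂))) (b := ξ g₁) (c := ξ g₂)
  rw [coe_nnnorm, e]
  push_cast
  linarith

variable (ξ) in
/-- The total variation of `ξ` as a positive linear functional. -/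
noncomputable def variation : C_c(Y, ℝ≥0) →ₗ[ℝ≥0] ℝ≥0 where
  toFun := variationAux ξ
  map_add' f₁ f₂ := (variationAux_add_le f₁ f₂).antisymm (add_variationAux_le f₁ f₂)
  map_smul' c f := variationAux_smul c f

/-- A functional on `C₀(Y)` is dominated by a finite measure, namely its total variation. -/
theorem exists_measure_norm_le_integral [T2Space Y] [LocallyCompactSpace Y] [MeasurableSpace Y]
    [BorelSpace Y] (ξ : C₀(Y, ℂ) →L[ℂ] ℂ) :
    ∃ μ : Measure Y, IsFiniteMeasure μ ∧ ∀ f : C₀(Y, ℂ), ‖ξ f‖ ≤ ∫ y, ‖f y‖ ∂μ := by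
  set μ := NNRealRMK.rieszMeasure (variation ξ)
  have hfin : μ Set.univ ≤ ‖ξ‖₊ := by
    rw [isOpen_univ.measure_eq_iSup_isCompact]
    refine iSup₂_le fun K _ => iSup_le fun hK => ?_
    obtain ⟨φ, h1, -, hc, h01⟩ :=
      exists_continuous_one_zero_of_isCompact hK isClosed_empty (Set.disjoint_empty K)
    let ψ : C_c(Y, ℝ≥0) := CompactlySupportedContinuousMap.nnrealPart ⟨φ, hc⟩
    have hψ1 : ∀ y, ψ y ≤ 1 := fun y => Real.toNNReal_le_one.2 (h01 y).2
    have hψK : ∀ y ∈ K, ψ y = 1 := fun y hy => by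
      change (φ y).toNNReal = 1
      rw [h1 hy]
      simp
    calc μ K = ∫⁻ y in K, 1 ∂μ := by simp
      _ = ∫⁻ y in K, (ψ y : ℝ≥0∞) ∂μ :=
        setLIntegral_congr_fun hK.measurableSet fun y hy => by simp [hψK y hy]
      _ ≤ ∫⁻ y, (ψ y : ℝ≥0∞) ∂μ := setLIntegral_le_lintegral _ _
      _ = variation ξ ψ := NNRealRMK.lintegral_rieszMeasure _ _
      _ ≤ ‖ξ‖₊ := by
        have : variation ξ ψ ≤ ‖ξ‖₊ * 1 := variationAux_le hψ1
        rw [mul_one] at this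
        exact_mod_cast this
  have hμ : IsFiniteMeasure μ := ⟨hfin.trans_lt ENNReal.coe_lt_top⟩
  refine ⟨μ, hμ, fun f => ?_⟩
  have hint : Integrable (fun y => ‖f y‖) μ :=
    Integrable.of_bound (f.continuous.norm.aestronglyMeasurable) ‖f‖
      (ae_of_all _ fun y => by simpa using f.norm_apply_le y)
  refine le_of_forall_pos_le_add fun ε hε => ?_
  obtain ⟨δ, hδ, hδε⟩ : ∃ δ > 0, ‖ξ‖ * δ ≤ ε :=
    ⟨ε / (‖ξ‖ + 1), by positivity, by
      rw [mul_div_assoc', div_le_iff₀ (by positivity)]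
      nlinarith [norm_nonneg ξ]⟩
  -- truncate: `φ = (|f| - δ)⁺` has compact support, and `f` is `δ`-close to `f φ / (φ + δ)`
  let φ : C_c(Y, ℝ≥0) :=
    { toFun := fun y => (‖f y‖ - δ).toNNReal
      continuous_toFun := by fun_prop
      hasCompactSupport' := by
        refine HasCompactSupport.intro (f.isCompact_norm_ge hδ) fun y hy => ?_
        rw [Set.mem_ofPred_eq, not_le] at hy
        exact Real.toNNReal_of_nonpos (by linarith) }
  have hφ : ∀ y, (φ y : ℝ) = max (‖f y‖ - δ) 0 := fun y => Real.coe_toNNReal' _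
  have hφf : ∀ y, ‖f y‖ ≤ φ y + δ := fun y => by
    rw [hφ]
    linarith [le_max_left (‖f y‖ - δ) 0]
  have hpos : ∀ y, (0 : ℝ) < φ y + δ := fun y => by positivity
  have hφc : Continuous fun y => (φ y : ℝ) := NNReal.continuous_coe.comp φ.continuous
  let g : C₀(Y, ℂ) := ofLE f (fun y => f y * (((φ y : ℝ) / (φ y + δ) : ℝ) : ℂ))
    (f.continuous.mul (Complex.continuous_ofReal.comp
      (hφc.div (hφc.add continuous_const) fun y => (hpos y).ne'))) fun y => by
      rw [norm_mul]
      refine mul_le_of_le_one_right (norm_nonneg _) ?_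
      rw [Complex.norm_real, Real.norm_of_nonneg (by positivity), div_le_one (hpos y)]
      linarith
  have hg : ‖ξ g‖ ≤ variation ξ φ :=
    nnnorm_le_variationAux fun y => norm_mul_div_le (hpos y) (φ y).2 (hφf y)
  have hfg : ‖f - g‖ ≤ δ := norm_le_of_forall hδ.le fun y =>
    norm_sub_mul_div_le hδ (φ y).2 (hφf y)
  have hφle : (variation ξ φ : ℝ) ≤ ∫ y, ‖f y‖ ∂μ := by
    rw [← NNRealRMK.integral_rieszMeasure]
    refine integral_mono_of_nonneg (ae_of_all _ fun y => (φ y).2) hint (ae_of_all _ fun y => ?_)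
    simp only [hφ]
    exact max_le (by linarith) (norm_nonneg _)
  have e : ξ f = ξ (f - g) + ξ g := by simp
  have b : ‖ξ (f - g)‖ ≤ ‖ξ‖ * δ :=
    (ξ.le_opNorm _).trans (mul_le_mul_of_nonneg_left hfg (norm_nonneg _))
  rw [e]
  linarith [norm_add_le (ξ (f - g)) (ξ g)]

theorem _root_.tendsto_toWeakSpace_iff {X : Type*} [NormedAddCommGroup X] [NormedSpace ℂ X]
    {ι : Type*} {l : Filter ι} {x : ι → X} {a : X} :
    Tendsto (fun i => toWeakSpace ℂ X (x i)) l (𝓝 (toWeakSpace ℂ X a)) ↔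
      ∀ ξ : X →L[ℂ] ℂ, Tendsto (fun i => ξ (x i)) l (𝓝 (ξ a)) :=
  WeakBilin.tendsto_iff_forall_eval_tendsto (topDualPairing ℂ X).flip
    fun x y h => by
      by_contra hne
      obtain ⟨ξ, hξ⟩ := SeparatingDual.exists_separating_of_ne (R := ℂ) hne
      exact hξ (LinearMap.congr_fun h ξ)

/-- Bounded pointwise null families in `C₀(Y)` are weakly null, by dominated convergence with
respect to the total variation of a functional. -/
theorem tendsto_toWeakSpace_zero [T2Space Y] [LocallyCompactSpace Y] {ι : Type*} {l : Filter ι}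
    [l.IsCountablyGenerated] {f : ι → C₀(Y, ℂ)} {C : ℝ} (hC : ∀ i, ‖f i‖ ≤ C)
    (hf : ∀ y, Tendsto (fun i => f i y) l (𝓝 0)) :
    Tendsto (fun i => toWeakSpace ℂ C₀(Y, ℂ) (f i)) l (𝓝 0) := by
  borelize Y
  rw [← map_zero (toWeakSpace ℂ C₀(Y, ℂ)), tendsto_toWeakSpace_iff]
  intro ξ
  obtain ⟨μ, hμ, h⟩ := exists_measure_norm_le_integral ξ
  rw [map_zero]
  refine squeeze_zero_norm (fun i => h (f i)) ?_
  rw [← integral_zero Y ℝ (μ := μ)]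
  refine tendsto_integral_filter_of_dominated_convergence (fun _ => C)
    (Eventually.of_forall fun i => (f i).continuous.norm.aestronglyMeasurable)
    (Eventually.of_forall fun i => ae_of_all _ fun y => ?_) (integrable_const C)
    (ae_of_all _ fun y => by simpa using (hf y).norm)
  simpa using ((f i).norm_apply_le y).trans (hC i)

end ZeroAtInftyContinuousMap

end WeakNull

/-! ### The Koopman group of a flow -/

section KoopmanGroup

open ZeroAtInftyContinuousMap

variable {Y : Type*} [TopologicalSpace Y] (φ : Flow ℝ Y)

theorem koopman_zero : koopman φ 0 = 1 := by
  ext f x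
  simp [koopman_apply]

theorem koopman_add (s t : ℝ) : koopman φ (s + t) = koopman φ s * koopman φ t := by
  ext f x
  rw [koopman_apply, add_comm, φ.map_add]
  rfl

theorem koopman_one_pow (n : ℕ) : koopman φ 1 ^ n = koopman φ n := by
  induction n with
  | zero => simp [koopman_zero]
  | succ n ih => rw [pow_succ, ih, Nat.cast_succ, koopman_add]

theorem norm_koopman_apply_le (t : ℝ) (f : C₀(Y, ℂ)) : ‖koopman φ t f‖ ≤ ‖f‖ :=
  norm_le_of_forall (norm_nonneg _) fun x => f.norm_apply_le (φ t x)

theorem norm_koopman_apply (t : ℝ) (f : C₀(Y, ℂ)) : ‖koopman φ t f‖ = ‖f‖ := by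
  refine (norm_koopman_apply_le φ t f).antisymm ?_
  have h : koopman φ (-t) (koopman φ t f) = f := by
    rw [← mul_apply_eq_comp, ← koopman_add, neg_add_cancel, koopman_zero]
    rfl
  simpa [h] using norm_koopman_apply_le φ (-t) (koopman φ t f)

theorem norm_koopman_le_one (t : ℝ) : ‖koopman φ t‖ ≤ 1 :=
  ContinuousLinearMap.opNorm_le_bound _ zero_le_one fun f => by
    simpa using norm_koopman_apply_le φ t f

theorem isometry_koopman (t : ℝ) : Isometry (koopman φ t) :=
  AddMonoidHomClass.isometry_of_norm _ (norm_koopman_apply φ t)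

/-- A point where `|f|` is small at time `0` and at time `t` causes no trouble; all other points lie
in a compact set, where joint continuity of the flow is uniform. -/
theorem tendsto_koopman_nhds_zero (f : C₀(Y, ℂ)) :
    Tendsto (fun t => koopman φ t f) (𝓝 0) (𝓝 f) := by
  rw [Metric.tendsto_nhds]
  intro ε hε
  have hK := f.isCompact_norm_ge (ε := ε / 3) (by positivity)
  have hK' := (isCompact_Icc (a := (-1 : ℝ)) (b := 1)).prod hK |>.image φ.cont'
  have h1 : ∀ᶠ t in 𝓝 (0 : ℝ), ∀ y ∈ Function.uncurry φ.toFun ''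
      Set.Icc (-1 : ℝ) 1 ×ˢ {y | ε / 3 ≤ ‖f y‖}, ‖f (φ t y) - f y‖ < 2 * ε / 3 := by
    refine hK'.eventually_forall_of_forall_eventually fun y _ => ?_
    have hc : Continuous fun z : ℝ × Y => ‖f (φ z.1 z.2) - f z.2‖ :=
      ((f.continuous.comp φ.cont').sub (f.continuous.comp continuous_snd)).norm
    refine hc.continuousAt.eventually (gt_mem_nhds ?_)
    simp only [φ.map_zero_apply, sub_self, norm_zero]
    positivity
  have h2 : ∀ᶠ t in 𝓝 (0 : ℝ), t ∈ Set.Icc (-1 : ℝ) 1 := Icc_mem_nhds (by simp) (by simp)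
  filter_upwards [h1, h2] with t ht1 ht2
  rw [dist_eq_norm]
  refine (norm_le_of_forall (c := 2 * ε / 3) (by positivity) fun y => ?_).trans_lt (by linarith)
  change ‖f (φ t y) - f y‖ ≤ _
  by_cases hy : ε / 3 ≤ ‖f y‖
  · exact (ht1 y ⟨(0, y), ⟨by simp, hy⟩, φ.map_zero_apply y⟩).le
  by_cases hty : ε / 3 ≤ ‖f (φ t y)‖
  · refine (ht1 y ⟨(-t, φ t y), ⟨⟨by linarith [ht2.2], by linarith [ht2.1]⟩, hty⟩, ?_⟩).le
    change φ (-t) (φ t y) = y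
    rw [← φ.map_add, neg_add_cancel, φ.map_zero_apply]
  · linarith [norm_sub_le (f (φ t y)) (f y)]

theorem continuous_koopman (f : C₀(Y, ℂ)) : Continuous fun t => koopman φ t f := by
  refine continuous_iff_continuousAt.2 fun s => ?_
  have h := (koopman φ s).continuous.continuousAt.tendsto.comp (tendsto_koopman_nhds_zero φ f)
  have h' : Tendsto (fun t => t - s) (𝓝 s) (𝓝 0) := by
    simpa using (continuous_id.sub continuous_const).tendsto (x := s) (f := fun t : ℝ => t - s)
  refine (h.comp h').congr fun t => ?_
  simp only [Function.comp_apply]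
  rw [← mul_apply_eq_comp, ← koopman_add, add_sub_cancel]

end KoopmanGroup

/-! ### The flow on the circle -/

section Circle

theorem norm_homoclinic (u : ℝ) : ‖homoclinic u‖ = 1 := by
  unfold homoclinic
  split_ifs <;> exact Complex.norm_exp_ofReal_mul_I _

theorem homoclinic_of_nonpos {u : ℝ} (hu : u ≤ 0) :
    homoclinic u = Complex.exp ((Real.pi / (u - 1) : ℝ) * Complex.I) := by
  unfold homoclinic
  split_ifs with h
  · have : u = 0 := le_antisymm hu h
    subst this
    have e : ((Real.pi / (0 - 1) : ℝ) : ℂ) * Complex.I = -(Real.pi * Complex.I) := by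
      push_cast
      ring
    rw [e, Complex.exp_neg, Complex.exp_pi_mul_I]
    simp [Complex.exp_pi_mul_I]
  · rfl

theorem homoclinic_of_nonneg {u : ℝ} (hu : 0 ≤ u) :
    homoclinic u = Complex.exp ((Real.pi / (u + 1) : ℝ) * Complex.I) := if_pos hu

theorem norm_homoclinic_sub_one_le (u : ℝ) : ‖homoclinic u - 1‖ ≤ Real.pi / (|u| + 1) := by
  have key : ∀ θ : ℝ, ‖Complex.exp (θ * Complex.I) - 1‖ ≤ |θ| := fun θ => by
    rw [mul_comm]
    simpa using Real.norm_exp_I_mul_ofReal_sub_one_le (x := θ)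
  rcases le_total 0 u with hu | hu
  · rw [homoclinic_of_nonneg hu, abs_of_nonneg hu]
    refine (key _).trans (le_of_eq (abs_of_nonneg (by positivity)))
  · rw [homoclinic_of_nonpos hu, abs_of_nonpos hu]
    refine (key _).trans (le_of_eq ?_)
    rw [abs_div, abs_of_pos Real.pi_pos, abs_of_neg (by linarith)]
    ring

theorem tendsto_homoclinic_cocompact : Tendsto homoclinic (cocompact ℝ) (𝓝 1) := by
  rw [tendsto_iff_norm_sub_tendsto_zero]
  refine squeeze_zero (fun _ => norm_nonneg _) norm_homoclinic_sub_one_le ?_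
  exact Tendsto.div_atTop tendsto_const_nhds
    (tendsto_atTop_add_const_right _ _ (tendsto_norm_cocompact_atTop (E := ℝ)))

theorem continuous_homoclinic : Continuous homoclinic := by
  have h : homoclinic = fun u : ℝ => Complex.exp ((if 0 ≤ u then Real.pi / (u + 1)
      else 2 * Real.pi + Real.pi / (u - 1) : ℝ) * Complex.I) := by
    ext u
    unfold homoclinic
    split_ifs
    · rfl
    · push_cast
      rw [add_mul, Complex.exp_add, Complex.exp_two_pi_mul_I, one_mul]
  rw [h]
  refine Complex.continuous_exp.comp ((Complex.continuous_ofReal.comp ?_).mul continuous_const)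
  refine continuous_if_le continuous_const continuous_id ?_ ?_ ?_
  · exact ContinuousOn.div continuousOn_const (by fun_prop) fun u (hu : 0 ≤ u) => by positivity
  · exact continuousOn_const.add (ContinuousOn.div continuousOn_const (by fun_prop)
      fun u (hu : u ≤ 0) => by linarith)
  · intro u hu
    subst hu
    ring

/-- The time at which the orbit `homoclinic` of `-1` passes through the point `z ≠ 1` of the unit
circle. -/
noncomputable def circleTime (z : ℂ) : ℝ :=
  if 0 ≤ z.im then Real.pi / Real.arccos z.re - 1 else 1 - Real.pi / Real.arccos z.re

theorem circleTime_homoclinic (u : ℝ) : circleTime (homoclinic u) = u := by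
  have hπ := Real.pi_pos
  rcases le_or_gt 0 u with hu | hu
  · have h1 : Real.pi / (u + 1) ≤ Real.pi := div_le_self hπ.le (by linarith)
    rw [homoclinic_of_nonneg hu, circleTime, Complex.exp_ofReal_mul_I_im,
      Complex.exp_ofReal_mul_I_re, if_pos (Real.sin_nonneg_of_nonneg_of_le_pi (by positivity) h1),
      Real.arccos_cos (by positivity) h1]
    field_simp
    ring
  · have h0 : 0 < Real.pi / (1 - u) := div_pos hπ (by linarith)
    have h1 : Real.pi / (1 - u) < Real.pi := div_lt_self hπ (by linarith)
    have e : Real.pi / (u - 1) = -(Real.pi / (1 - u)) := by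
      rw [← div_neg, neg_sub]
    have hne : (1 - u) ≠ 0 := by linarith
    rw [homoclinic_of_nonpos hu.le, circleTime, Complex.exp_ofReal_mul_I_im,
      Complex.exp_ofReal_mul_I_re, e, Real.sin_neg, Real.cos_neg,
      if_neg (by linarith [Real.sin_pos_of_pos_of_lt_pi h0 h1]), Real.arccos_cos h0.le h1.le]
    field_simp
    ring

theorem homoclinic_circleTime {z : ℂ} (hz : ‖z‖ = 1) (h1 : z ≠ 1) :
    homoclinic (circleTime z) = z := by
  have hπ := Real.pi_pos
  have hsq : z.re ^ 2 + z.im ^ 2 = 1 := by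
    have := Complex.sq_norm z
    rw [hz, Complex.normSq_apply] at this
    linarith
  have hre : -1 ≤ z.re := by nlinarith [sq_nonneg z.im]
  have hre' : z.re < 1 := by
    refine lt_of_le_of_ne (by nlinarith [sq_nonneg z.im]) fun h => h1 ?_
    have him : z.im = 0 := by
      rw [h] at hsq
      nlinarith
    exact Complex.ext (by simpa using h) (by simpa using him)
  have ha : 0 < Real.arccos z.re := Real.arccos_pos.2 hre'
  have ha' : Real.arccos z.re ≤ Real.pi := Real.arccos_le_pi _
  have h1le : 1 ≤ Real.pi / Real.arccos z.re := (one_le_div ha).2 ha'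
  have hsin : Real.sin (Real.arccos z.re) = |z.im| := by
    rw [Real.sin_arccos, ← hsq, add_sub_cancel_left, Real.sqrt_sq_eq_abs]
  have hcos := Real.cos_arccos hre hre'.le
  unfold circleTime
  split_ifs with him
  · rw [homoclinic_of_nonneg (by linarith), sub_add_cancel, div_div_cancel₀ hπ.ne']
    apply Complex.ext
    · rw [Complex.exp_ofReal_mul_I_re, hcos]
    · rw [Complex.exp_ofReal_mul_I_im, hsin, abs_of_nonneg him]
  · have e : Real.pi / (1 - Real.pi / Real.arccos z.re - 1) = -Real.arccos z.re := by
      rw [sub_sub_cancel_left, div_neg, div_div_cancel₀ hπ.ne']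
    rw [homoclinic_of_nonpos (by linarith), e]
    apply Complex.ext
    · rw [Complex.exp_ofReal_mul_I_re, Real.cos_neg, hcos]
    · rw [Complex.exp_ofReal_mul_I_im, Real.sin_neg, hsin, abs_of_neg (not_le.1 him), neg_neg]

theorem homoclinic_ne_one (u : ℝ) : homoclinic u ≠ 1 := fun h => by
  -- with the convention `π / 0 = 0`, the only candidate is `u = circleTime 1 = -1`
  have hu := circleTime_homoclinic u
  have h1 : circleTime 1 = -1 := by simp [circleTime]
  rw [h, h1] at hu
  rw [← hu, homoclinic_of_nonpos (by norm_num)] at h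
  have h2 := congrArg Complex.re h
  rw [Complex.exp_ofReal_mul_I_re, show Real.pi / (-1 - 1) = -(Real.pi / 2) by ring, Real.cos_neg,
    Real.cos_pi_div_two] at h2
  simp at h2

theorem continuousOn_circleTime : ContinuousOn circleTime (Metric.sphere 0 1 \ {1}) := by
  rw [continuousOn_iff_continuous_domRestrict]
  have hre : ∀ z : ↥(Metric.sphere (0 : ℂ) 1 \ {1}), (z : ℂ).re ^ 2 + (z : ℂ).im ^ 2 = 1 := by
    rintro ⟨z, hz, -⟩
    have := Complex.sq_norm z
    rw [mem_sphere_zero_iff_norm.1 hz, Complex.normSq_apply] at this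
    change z.re ^ 2 + z.im ^ 2 = 1
    linarith
  have hne : ∀ z : ↥(Metric.sphere (0 : ℂ) 1 \ {1}), Real.arccos (z : ℂ).re ≠ 0 := by
    intro z h
    refine z.2.2 (Complex.ext ?_ ?_)
    · simp only [Complex.one_re]
      nlinarith [Real.arccos_eq_zero.1 h, hre z, sq_nonneg (z : ℂ).im]
    · simp only [Complex.one_im]
      nlinarith [Real.arccos_eq_zero.1 h, hre z, sq_nonneg (z : ℂ).im]
  have hc : Continuous fun z : ↥(Metric.sphere (0 : ℂ) 1 \ {1}) =>
      Real.pi / Real.arccos (z : ℂ).re :=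
    continuous_const.div (Real.continuous_arccos.comp
      (Complex.continuous_re.comp continuous_subtype_val)) hne
  refine Continuous.if_le (hc.sub continuous_const) (continuous_const.sub hc) continuous_const
    (Complex.continuous_im.comp continuous_subtype_val) fun z (hz : 0 = (z : ℂ).im) => ?_
  have h1 : (z : ℂ).re = -1 := by
    have h2 := hre z
    rw [← hz] at h2
    have h3 : (z : ℂ).re ^ 2 = 1 := by linarith
    rcases (by simpa using h3 : (z : ℂ).re = 1 ∨ (z : ℂ).re = -1) with h | h
    · exact absurd (by rw [h, Real.arccos_one]) (hne z)
    · exact h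
  rw [h1, Real.arccos_neg_one, div_self Real.pi_ne_zero]

theorem tendsto_norm_atTop_iff_cocompact {ι : Type*} {l : Filter ι} {f : ι → ℝ} :
    Tendsto (fun i => ‖f i‖) l atTop ↔ Tendsto f l (cocompact ℝ) := by
  rw [tendsto_norm_atTop_iff_cobounded, Metric.cobounded_eq_cocompact]

theorem tendsto_circleTime_cocompact :
    Tendsto circleTime (𝓝[Metric.sphere 0 1 \ {1}] 1) (cocompact ℝ) := by
  rw [← tendsto_norm_atTop_iff_cocompact]
  have h1 : Tendsto (fun z : ℂ => Real.arccos z.re) (𝓝[Metric.sphere 0 1 \ {1}] 1) (𝓝[>] 0) := by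
    refine tendsto_nhdsWithin_iff.2 ⟨?_, ?_⟩
    · have : Continuous fun z : ℂ => Real.arccos z.re :=
        Real.continuous_arccos.comp Complex.continuous_re
      simpa using (this.tendsto 1).mono_left nhdsWithin_le_nhds
    · filter_upwards [self_mem_nhdsWithin] with z hz
      refine Real.arccos_pos.2 (lt_of_not_ge fun h => hz.2 ?_)
      have h2 := Complex.sq_norm z
      rw [mem_sphere_zero_iff_norm.1 hz.1, Complex.normSq_apply] at h2
      refine Complex.ext ?_ ?_
      · simp only [Complex.one_re]
        nlinarith [sq_nonneg z.im]
      · simp only [Complex.one_im]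
        nlinarith [sq_nonneg z.im]
  have h2 : Tendsto (fun z : ℂ => Real.pi / Real.arccos z.re - 1)
      (𝓝[Metric.sphere 0 1 \ {1}] 1) atTop :=
    tendsto_atTop_add_const_right _ _
      ((tendsto_inv_nhdsGT_zero.comp h1).const_mul_atTop Real.pi_pos)
  refine tendsto_atTop_mono (fun z => ?_) h2
  unfold circleTime
  split_ifs
  · exact le_abs_self _
  · rw [← neg_sub]
    exact neg_le_abs _

/-- The flow on the unit circle that fixes `1` and moves all other points along `homoclinic`. -/
noncomputable def circleFlow (t : ℝ) (z : ℂ) : ℂ :=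
  if z = 1 then 1 else homoclinic (circleTime z + t)

theorem circleFlow_one (t : ℝ) : circleFlow t 1 = 1 := if_pos rfl

theorem circleFlow_homoclinic (t u : ℝ) : circleFlow t (homoclinic u) = homoclinic (u + t) := by
  rw [circleFlow, if_neg (homoclinic_ne_one u), circleTime_homoclinic]

theorem continuousOn_circleFlow :
    ContinuousOn (Function.uncurry circleFlow) (Set.univ ×ˢ Metric.sphere 0 1) := by
  rintro ⟨t₀, z₀⟩ ⟨-, hz₀ : z₀ ∈ Metric.sphere (0 : ℂ) 1⟩
  by_cases h1 : z₀ = 1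
  · subst h1
    rw [ContinuousWithinAt, Function.uncurry_apply_pair, circleFlow_one, nhdsWithin_prod_eq,
      nhdsWithin_univ]
    have hs : Metric.sphere (0 : ℂ) 1 = insert 1 (Metric.sphere 0 1 \ {1}) := by
      rw [Set.insert_sdiff_singleton, Set.insert_eq_of_mem hz₀]
    rw [hs, nhdsWithin_insert, prod_sup, tendsto_sup]
    constructor
    · refine tendsto_const_nhds.congr' ?_
      have : ∀ᶠ z : ℂ in pure 1, z = 1 := by simp
      filter_upwards [this.prod_inr (𝓝 t₀)] with p hp
      rw [Function.uncurry, hp, circleFlow_one]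
    · have h2 : Tendsto (fun p : ℝ × ℂ => homoclinic (circleTime p.2 + p.1))
          (𝓝 t₀ ×ˢ 𝓝[Metric.sphere 0 1 \ {1}] 1) (𝓝 1) := by
        refine tendsto_homoclinic_cocompact.comp (tendsto_norm_atTop_iff_cocompact.1 ?_)
        have h3 : Tendsto (fun p : ℝ × ℂ => ‖circleTime p.2‖ + -(|t₀| + 1))
            (𝓝 t₀ ×ˢ 𝓝[Metric.sphere 0 1 \ {1}] 1) atTop :=
          tendsto_atTop_add_const_right _ _
            ((tendsto_norm_atTop_iff_cocompact.2 tendsto_circleTime_cocompact).comp tendsto_snd)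
        refine tendsto_atTop_mono' _ ?_ h3
        have h4 : ∀ᶠ t in 𝓝 t₀, |t| < |t₀| + 1 :=
          continuous_abs.continuousAt.eventually (gt_mem_nhds (lt_add_one _))
        filter_upwards [h4.prod_inl _] with p hp
        have := norm_sub_norm_le (circleTime p.2) (-p.1)
        rw [sub_neg_eq_add, norm_neg, Real.norm_eq_abs p.1] at this
        linarith
      refine h2.congr' ?_
      have h5 : ∀ᶠ z : ℂ in 𝓝[Metric.sphere 0 1 \ {1}] 1, z ≠ 1 := by
        filter_upwards [self_mem_nhdsWithin] with z hz using hz.2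
      filter_upwards [h5.prod_inr (𝓝 t₀)] with p hp
      rw [Function.uncurry, circleFlow, if_neg hp]
  · have hct : ContinuousWithinAt circleTime (Metric.sphere 0 1) z₀ :=
      (continuousOn_circleTime z₀ ⟨hz₀, h1⟩).mono_of_mem_nhdsWithin
        (inter_mem_nhdsWithin _ (isOpen_compl_singleton.mem_nhds h1))
    have h2 : ContinuousWithinAt (fun p : ℝ × ℂ => homoclinic (circleTime p.2 + p.1))
        (Set.univ ×ˢ Metric.sphere 0 1) (t₀, z₀) :=
      have h3 : ContinuousWithinAt (fun p : ℝ × ℂ => circleTime p.2)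
          (Set.univ ×ˢ Metric.sphere 0 1) (t₀, z₀) :=
        ContinuousWithinAt.comp (f := (Prod.snd : ℝ × ℂ → ℂ)) (x := (t₀, z₀))
          (t := Metric.sphere 0 1) hct continuousWithinAt_snd fun p hp => hp.2
      continuous_homoclinic.continuousAt.comp_continuousWithinAt (h3.add continuousWithinAt_fst)
    refine h2.congr_of_eventuallyEq ?_ (if_neg h1)
    have h3 : ∀ᶠ p : ℝ × ℂ in 𝓝 (t₀, z₀), p.2 ≠ 1 :=
      continuous_snd.continuousAt.eventually_ne h1
    filter_upwards [nhdsWithin_le_nhds h3] with p hp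
    exact if_neg hp

end Circle

/-! ### The spiral -/

section Spiral

theorem spiralRadius_of_one_le {t : ℝ} (ht : 1 ≤ t) : spiralRadius t = 1 - 1 / (2 * t) := if_pos ht

theorem spiralRadius_of_le_one {t : ℝ} (ht : t ≤ 1) : spiralRadius t = Real.exp (t - 1) / 2 := by
  unfold spiralRadius
  split_ifs with h
  · have : t = 1 := le_antisymm ht h
    subst this
    norm_num
  · rfl

theorem spiralRadius_pos (t : ℝ) : 0 < spiralRadius t := by
  rcases le_total 1 t with ht | ht
  · rw [spiralRadius_of_one_le ht, sub_pos, div_lt_one (by positivity)]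
    linarith
  · rw [spiralRadius_of_le_one ht]
    positivity

theorem norm_spiral (t : ℝ) : ‖spiral t‖ = spiralRadius t := by
  rw [spiral, norm_mul, Complex.norm_exp_ofReal_mul_I, mul_one, Complex.norm_real,
    Real.norm_of_nonneg (spiralRadius_pos t).le]

theorem spiralRadius_lt_one (t : ℝ) : spiralRadius t < 1 :=
  norm_spiral t ▸ spiral_norm_lt_one t

theorem continuous_spiralRadius : Continuous spiralRadius := by
  refine continuous_if_le continuous_const continuous_id ?_ ?_ ?_
  · refine continuousOn_const.sub (continuousOn_const.div (by fun_prop) fun t (ht : 1 ≤ t) => ?_)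
    positivity
  · fun_prop
  · intro t ht
    subst ht
    norm_num

theorem continuous_spiralAngle : Continuous spiralAngle := by
  obtain ⟨hA, hB, hC, -, hE⟩ := spiralAngle_spec
  have step : ∀ n : ℕ, ContinuousOn spiralAngle
      (Set.Iic (2 * ((n : ℝ) + 1) ^ 2 + ((n : ℝ) + 1) + 1)) := by
    have block : ∀ (k : ℤ), 1 ≤ k → ContinuousOn spiralAngle
        (Set.Icc (2 * (k : ℝ) ^ 2 - 3 * k + 2) (2 * (k : ℝ) ^ 2 + k + 1)) := by
      intro k hk
      have hk' : (1 : ℝ) ≤ k := by exact_mod_cast hk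
      have hk0 : (k : ℝ) ≠ 0 := by linarith
      have cC : ContinuousOn spiralAngle
          (Set.Icc (2 * (k : ℝ) ^ 2 - 3 * k + 2) (2 * (k : ℝ) ^ 2 - k + 2)) := by
        refine ContinuousOn.congr (Continuous.continuousOn ?_) fun t ht => hC k hk t ht.1 ht.2
        fun_prop
      have cA : ContinuousOn spiralAngle
          (Set.Icc (2 * (k : ℝ) ^ 2 - k + 2) (2 * (k : ℝ) ^ 2 + 1)) := by
        refine ContinuousOn.congr ?_ fun t ht => hA k hk t ht.1 ht.2
        refine continuousOn_const.sub (continuousOn_const.div (by fun_prop) fun t ht => ?_)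
        linarith [ht.2]
      have cB : ContinuousOn spiralAngle
          (Set.Icc (2 * (k : ℝ) ^ 2 + 1) (2 * (k : ℝ) ^ 2 + k + 1)) := by
        refine ContinuousOn.congr ?_ fun t ht => hB k hk t ht.1 ht.2
        refine continuousOn_const.add (continuousOn_const.div (by fun_prop) fun t ht => ?_)
        linarith [ht.1]
      rw [← Set.Icc_union_Icc_eq_Icc (b := 2 * (k : ℝ) ^ 2 - k + 2) (by linarith) (by linarith),
        ← Set.Icc_union_Icc_eq_Icc (a := 2 * (k : ℝ) ^ 2 - k + 2) (b := 2 * (k : ℝ) ^ 2 + 1)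
          (by linarith) (by linarith)]
      exact cC.union_of_isClosed (cA.union_of_isClosed cB isClosed_Icc isClosed_Icc) isClosed_Icc
        (isClosed_Icc.union isClosed_Icc)
    have cE : ContinuousOn spiralAngle (Set.Iic 3) :=
      ContinuousOn.congr (Continuous.continuousOn (by fun_prop)) hE
    intro n
    induction n with
    | zero =>
      have h := block 1 le_rfl
      norm_num at h ⊢
      rw [← Set.Iic_union_Icc_eq_Iic (show (1 : ℝ) ≤ 4 by norm_num)]
      exact (cE.mono (Set.Iic_subset_Iic.2 (by norm_num))).union_of_isClosed h isClosed_Iic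
        isClosed_Icc
    | succ n ih =>
      have h := block (n + 2) (by omega)
      push_cast at h ⊢
      have e : 2 * ((n : ℝ) + 2) ^ 2 - 3 * (n + 2) + 2
          = 2 * ((n : ℝ) + 1) ^ 2 + ((n : ℝ) + 1) + 1 := by ring
      rw [e] at h
      have e' : (n : ℝ) + 1 + 1 = n + 2 := by ring
      rw [e', ← Set.Iic_union_Icc_eq_Iic
        (show 2 * ((n : ℝ) + 1) ^ 2 + ((n : ℝ) + 1) + 1 ≤ 2 * ((n : ℝ) + 2) ^ 2 + (n + 2) + 1 by
          nlinarith [n.cast_nonneg (α := ℝ)])]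
      exact ih.union_of_isClosed h isClosed_Iic isClosed_Icc
  refine continuous_iff_continuousAt.2 fun t => ?_
  obtain ⟨n, hn⟩ := exists_nat_gt t
  refine (step n).continuousAt (Iic_mem_nhds (hn.trans ?_))
  nlinarith [n.cast_nonneg (α := ℝ)]

theorem continuous_spiral : Continuous spiral := by
  have h1 := continuous_spiralRadius
  have h2 := continuous_spiralAngle
  unfold spiral
  fun_prop

/-- The time at which the spiral crosses the circle of radius `‖z‖` around `0`, for `0 < ‖z‖ < 1`. -/
noncomputable def spiralTime (z : ℂ) : ℝ :=
  if ‖z‖ ≤ 1 / 2 then 1 + Real.log (2 * ‖z‖) else 1 / (2 * (1 - ‖z‖))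

theorem spiralTime_spiral (t : ℝ) : spiralTime (spiral t) = t := by
  rw [spiralTime, norm_spiral]
  rcases le_or_gt t 1 with ht | ht
  · rw [spiralRadius_of_le_one ht, if_pos, mul_div_cancel₀ _ two_ne_zero, Real.log_exp]
    · ring
    · have : Real.exp (t - 1) ≤ 1 := Real.exp_le_one_iff.2 (by linarith)
      linarith
  · rw [spiralRadius_of_one_le ht.le, if_neg, sub_sub_cancel]
    · field_simp
    · have : 1 / (2 * t) < 1 / 2 := one_div_lt_one_div_of_lt two_pos (by linarith)
      linarith

theorem continuousOn_spiralTime : ContinuousOn spiralTime {z | 0 < ‖z‖ ∧ ‖z‖ < 1} := by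
  rw [continuousOn_iff_continuous_domRestrict]
  have hc : Continuous fun z : {z : ℂ | 0 < ‖z‖ ∧ ‖z‖ < 1} => ‖(z : ℂ)‖ :=
    continuous_subtype_val.norm
  refine Continuous.if_le ?_ ?_ hc continuous_const ?_
  · exact continuous_const.add ((continuous_const.mul hc).log fun z => by
      have := z.2.1
      exact mul_ne_zero two_ne_zero this.ne')
  · refine continuous_const.div (continuous_const.mul (continuous_const.sub hc)) fun z => ?_
    have := z.2.2
    exact mul_ne_zero two_ne_zero (by linarith)
  · intro z hz
    rw [hz]
    norm_num

theorem spiralTime_ge {z : ℂ} (hz : 1 / 2 < ‖z‖) : spiralTime z = 1 / (2 * (1 - ‖z‖)) :=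
  if_neg (not_le.2 hz)

/-- Near the unit circle, the spiral is at a late time. -/
theorem tendsto_spiralTime_atTop {z₀ : ℂ} (hz₀ : ‖z₀‖ = 1) :
    Tendsto spiralTime (𝓝[{z | ‖z‖ < 1}] z₀) atTop := by
  have h1 : Tendsto (fun z : ℂ => 2 * (1 - ‖z‖)) (𝓝[{z | ‖z‖ < 1}] z₀) (𝓝[>] 0) := by
    refine tendsto_nhdsWithin_iff.2 ⟨?_, ?_⟩
    · have : Continuous fun z : ℂ => 2 * (1 - ‖z‖) := by fun_prop
      simpa [hz₀] using (this.tendsto z₀).mono_left nhdsWithin_le_nhds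
    · filter_upwards [self_mem_nhdsWithin] with z (hz : ‖z‖ < 1)
      simpa using hz
  refine (tendsto_inv_nhdsGT_zero.comp h1).congr' ?_
  have h2 : ∀ᶠ z : ℂ in 𝓝 z₀, 1 / 2 < ‖z‖ :=
    continuous_norm.continuousAt.eventually (lt_mem_nhds (by norm_num [hz₀]))
  filter_upwards [nhdsWithin_le_nhds h2] with z hz
  rw [spiralTime_ge hz, Function.comp_apply, one_div]

/-! ### Comparison of the spiral with the flow on the circle -/

theorem spiralRound_spec {t : ℝ} (ht : 1 ≤ t) : 1 ≤ spiralRound t ∧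
    2 * (spiralRound t : ℝ) ^ 2 - 3 * spiralRound t + 2 ≤ t ∧
    t < 2 * (spiralRound t : ℝ) ^ 2 + spiralRound t + 1 := by
  set k := spiralRound t with hk
  have hs : (1 : ℝ) ≤ √(8 * t - 7) := Real.one_le_sqrt.2 (by linarith)
  have h1 : 1 ≤ k := by
    rw [hk, spiralRound, Int.le_floor]
    push_cast
    linarith
  have h1' : (1 : ℝ) ≤ k := by exact_mod_cast h1
  have hsq : √(8 * t - 7) ^ 2 = 8 * t - 7 := Real.sq_sqrt (by linarith)
  have h2 : (k : ℝ) ≤ (3 + √(8 * t - 7)) / 4 := Int.floor_le _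
  have h3 : (3 + √(8 * t - 7)) / 4 < k + 1 := Int.lt_floor_add_one _
  refine ⟨h1, ?_, ?_⟩
  · nlinarith
  · nlinarith

theorem tendsto_spiralRound : Tendsto spiralRound atTop atTop := by
  refine tendsto_floor_atTop.comp (Tendsto.atTop_div_const (by norm_num) ?_)
  refine tendsto_atTop_add_const_left _ _ (Real.tendsto_sqrt_atTop.comp ?_)
  exact tendsto_atTop_add_const_right _ _ (tendsto_id.const_mul_atTop (by norm_num))

/-- The time `t ≥ 1` counted from the instant `2k² + 1` at which the spiral, in its current round
`k`, meets the negative real axis. -/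
noncomputable def spiralOffset (t : ℝ) : ℝ := t - (2 * (spiralRound t : ℝ) ^ 2 + 1)

/-- During the central part of round `k`, the spiral moves at the same angular speed as the flow on
the circle. -/
theorem spiral_eq_mul_homoclinic {k : ℤ} (hk : 1 ≤ k) {t : ℝ} (h₁ : 2 * (k : ℝ) ^ 2 - k + 2 ≤ t)
    (h₂ : t ≤ 2 * (k : ℝ) ^ 2 + k + 1) :
    spiral t = spiralRadius t * homoclinic (t - (2 * (k : ℝ) ^ 2 + 1)) := by
  obtain ⟨hA, hB, -⟩ := spiralAngle_spec
  rw [spiral]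
  congr 1
  rcases le_total t (2 * (k : ℝ) ^ 2 + 1) with h | h
  · have e : (spiralAngle t : ℂ) * Complex.I =
        ((Real.pi / (t - (2 * (k : ℝ) ^ 2 + 1) - 1) : ℝ) : ℂ) * Complex.I
          + ((-k : ℤ) : ℂ) * (2 * Real.pi * Complex.I) := by
      have e' : t - (2 * (k : ℝ) ^ 2 + 1) - 1 = -(2 * (k : ℝ) ^ 2 + 2 - t) := by ring
      rw [hA k hk t h₁ h, e', div_neg]
      push_cast
      ring
    rw [homoclinic_of_nonpos (by linarith), e, Complex.exp_add, Complex.exp_int_mul_two_pi_mul_I,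
      mul_one]
  · have e : (spiralAngle t : ℂ) * Complex.I =
        ((Real.pi / (t - (2 * (k : ℝ) ^ 2 + 1) + 1) : ℝ) : ℂ) * Complex.I
          + ((-(k + 1) : ℤ) : ℂ) * (2 * Real.pi * Complex.I) := by
      have e' : t - (2 * (k : ℝ) ^ 2 + 1) + 1 = t - 2 * (k : ℝ) ^ 2 := by ring
      rw [hB k hk t h h₂, e']
      push_cast
      ring
    rw [homoclinic_of_nonneg (by linarith), e, Complex.exp_add, Complex.exp_int_mul_two_pi_mul_I,
      mul_one]

theorem norm_spiral_sub_homoclinic_le {k : ℤ} (hk : 1 ≤ k) {t : ℝ}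
    (h₁ : 2 * (k : ℝ) ^ 2 - k + 2 ≤ t) (h₂ : t ≤ 2 * (k : ℝ) ^ 2 + k + 1) :
    ‖spiral t - homoclinic (t - (2 * (k : ℝ) ^ 2 + 1))‖ ≤ 1 - spiralRadius t := by
  rw [spiral_eq_mul_homoclinic hk h₁ h₂, ← sub_one_mul, norm_mul, norm_homoclinic, mul_one,
    ← Complex.ofReal_one, ← Complex.ofReal_sub, Complex.norm_real, Real.norm_of_nonpos
      (by linarith [spiralRadius_lt_one t])]
  linarith

/-- At the beginning of a round, the spiral crosses a small sector around the direction `1`. -/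
theorem norm_spiral_sub_one_le {k : ℤ} (hk : 1 ≤ k) {t : ℝ}
    (h₁ : 2 * (k : ℝ) ^ 2 - 3 * k + 2 ≤ t) (h₂ : t ≤ 2 * (k : ℝ) ^ 2 - k + 2) :
    ‖spiral t - 1‖ ≤ 1 - spiralRadius t + Real.pi / k := by
  obtain ⟨-, -, hC, -⟩ := spiralAngle_spec
  have hk' : (1 : ℝ) ≤ k := by exact_mod_cast hk
  set θ : ℝ := (2 * (k : ℝ) ^ 2 - 2 * k + 2 - t) / (k : ℝ) ^ 2 * Real.pi with hθ
  have hθk : |θ| ≤ Real.pi / k := by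
    have h3 : |2 * (k : ℝ) ^ 2 - 2 * k + 2 - t| ≤ (k : ℝ) := abs_le.2 ⟨by linarith, by linarith⟩
    rw [hθ, abs_mul, abs_div, abs_of_pos Real.pi_pos, abs_of_pos (by positivity : 0 < (k : ℝ) ^ 2),
      div_mul_eq_mul_div, div_le_div_iff₀ (by positivity) (by positivity)]
    nlinarith [Real.pi_pos, mul_le_mul_of_nonneg_right h3
      (by positivity : 0 ≤ Real.pi * (k : ℝ))]
  have e : spiral t = spiralRadius t * Complex.exp (θ * Complex.I) := by
    have e' : (spiralAngle t : ℂ) * Complex.I = (θ : ℂ) * Complex.I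
        + ((-k : ℤ) : ℂ) * (2 * Real.pi * Complex.I) := by
      rw [hC k hk t h₁ h₂, ← hθ]
      push_cast
      ring
    rw [spiral, e', Complex.exp_add, Complex.exp_int_mul_two_pi_mul_I, mul_one]
  have e2 : spiral t - 1 = (spiralRadius t - 1 : ℝ) * Complex.exp (θ * Complex.I)
      + (Complex.exp (θ * Complex.I) - 1) := by
    rw [e]
    push_cast
    ring
  rw [e2]
  refine (norm_add_le _ _).trans (add_le_add ?_ ?_)
  · rw [norm_mul, Complex.norm_exp_ofReal_mul_I, mul_one, Complex.norm_real, Real.norm_of_nonpos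
      (by linarith [spiralRadius_lt_one t])]
    linarith
  · refine le_trans ?_ hθk
    rw [mul_comm (θ : ℂ)]
    simpa using Real.norm_exp_I_mul_ofReal_sub_one_le (x := θ)

theorem norm_sub_homoclinic_le_of_near_one {z : ℂ} {u a b c : ℝ} (hz : ‖z - 1‖ ≤ a + Real.pi / b)
    (hc : 0 < c) (hb : c ≤ b) (hu : c ≤ |u| + 1) :
    ‖z - homoclinic u‖ ≤ a + 2 * (Real.pi / c) := by
  have h1 := norm_homoclinic_sub_one_le u
  have h2 : Real.pi / b ≤ Real.pi / c := div_le_div_of_nonneg_left Real.pi_pos.le hc hb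
  have h3 : Real.pi / (|u| + 1) ≤ Real.pi / c := div_le_div_of_nonneg_left Real.pi_pos.le hc hu
  have h4 := norm_sub_le (z - 1) (homoclinic u - 1)
  rw [sub_sub_sub_cancel_right] at h4
  linarith

/-- Over bounded times, the spiral follows the circle flow up to an error that is small on late
rounds `k`: near the ends of a round, both are close to `1`. -/
theorem norm_spiral_add_sub_le {s t M : ℝ} (hs : 1 ≤ s) (ht : |t| ≤ M)
    (hM : M + 2 ≤ spiralRound s) :
    ‖spiral (s + t) - homoclinic (spiralOffset s + t)‖ ≤
      1 - spiralRadius (s + t) + 2 * (Real.pi / (spiralRound s - M)) := by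
  obtain ⟨hk, hl, hr⟩ := spiralRound_spec hs
  rw [spiralOffset]
  set k := spiralRound s
  have hM0 : 0 ≤ M := (abs_nonneg t).trans ht
  obtain ⟨ht₁, ht₂⟩ := abs_le.1 ht
  have hk2 : (2 : ℝ) ≤ k := by linarith
  have hkM : 0 < (k : ℝ) - M := by linarith
  rw [sub_add_eq_add_sub]
  have hxl : 2 * (k : ℝ) ^ 2 - 3 * k + 2 - M ≤ s + t := by linarith
  have hxr : s + t ≤ 2 * (k : ℝ) ^ 2 + k + 1 + M := by linarith
  generalize s + t = x at *
  have h0 : 0 ≤ Real.pi / (k - M) := div_nonneg Real.pi_pos.le hkM.le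
  rcases le_total x (2 * (k : ℝ) ^ 2 - 3 * k + 2) with hx | hx
  · -- `x` is near the end of the preceding round
    have h1 := norm_spiral_sub_homoclinic_le (k := k - 1) (by
        have : (2 : ℤ) ≤ k := by exact_mod_cast hk2
        omega) (t := x) (by push_cast; nlinarith) (by push_cast; nlinarith)
    push_cast at h1
    have h2 := norm_homoclinic_sub_one_le (x - (2 * ((k : ℝ) - 1) ^ 2 + 1))
    have h3 : Real.pi / (|x - (2 * ((k : ℝ) - 1) ^ 2 + 1)| + 1) ≤ Real.pi / (k - M) :=
      div_le_div_of_nonneg_left Real.pi_pos.le hkM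
        (by nlinarith [le_abs_self (x - (2 * ((k : ℝ) - 1) ^ 2 + 1))])
    refine norm_sub_homoclinic_le_of_near_one (b := k - M) ?_ hkM le_rfl ?_
    · have := norm_add_le (spiral x - homoclinic (x - (2 * ((k : ℝ) - 1) ^ 2 + 1)))
        (homoclinic (x - (2 * ((k : ℝ) - 1) ^ 2 + 1)) - 1)
      rw [sub_add_sub_cancel] at this
      linarith
    · linarith [neg_abs_le (x - (2 * (k : ℝ) ^ 2 + 1))]
  rcases le_total x (2 * (k : ℝ) ^ 2 - k + 2) with hx' | hx'
  · exact norm_sub_homoclinic_le_of_near_one (norm_spiral_sub_one_le hk hx hx') hkM (by linarith)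
      (by linarith [neg_abs_le (x - (2 * (k : ℝ) ^ 2 + 1))])
  rcases le_total x (2 * (k : ℝ) ^ 2 + k + 1) with hx'' | hx''
  · linarith [norm_spiral_sub_homoclinic_le hk hx' hx'']
  · -- `x` is near the beginning of the next round
    have h1 := norm_spiral_sub_one_le (k := k + 1) (by omega) (t := x) (by push_cast; nlinarith)
      (by push_cast; nlinarith)
    push_cast at h1
    exact norm_sub_homoclinic_le_of_near_one h1 hkM (by linarith)
      (by linarith [le_abs_self (x - (2 * (k : ℝ) ^ 2 + 1))])

theorem tendsto_spiralRadius_atTop : Tendsto spiralRadius atTop (𝓝 1) := by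
  have h : Tendsto (fun t : ℝ => 1 - 1 / (2 * t)) atTop (𝓝 (1 - 0)) :=
    tendsto_const_nhds.sub
      (tendsto_const_nhds.div_atTop (tendsto_id.const_mul_atTop two_pos))
  rw [sub_zero] at h
  refine h.congr' ?_
  filter_upwards [eventually_ge_atTop 1] with t ht using (spiralRadius_of_one_le ht).symm

/-- The spiral is asymptotic to the flow on the circle, locally uniformly in the elapsed time. -/
theorem tendsto_spiral_sub_homoclinic (t₀ : ℝ) :
    Tendsto (fun p : ℝ × ℝ => spiral (p.1 + p.2) - homoclinic (spiralOffset p.1 + p.2))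
      (atTop ×ˢ 𝓝 t₀) (𝓝 0) := by
  have hM : ∀ᶠ t in 𝓝 t₀, |t| ≤ |t₀| + 1 :=
    (continuous_abs.continuousAt.eventually (gt_mem_nhds (lt_add_one _))).mono fun _ h => le_of_lt h
  have hround : Tendsto (fun s => (spiralRound s : ℝ)) atTop atTop :=
    tendsto_intCast_atTop_atTop.comp tendsto_spiralRound
  have hlim : Tendsto (fun p : ℝ × ℝ => 1 - spiralRadius (p.1 + p.2)
      + 2 * (Real.pi / (spiralRound p.1 - (|t₀| + 1)))) (atTop ×ˢ 𝓝 t₀) (𝓝 (1 - 1 + 2 * 0)) := by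
    refine (tendsto_const_nhds.sub (tendsto_spiralRadius_atTop.comp
      (tendsto_fst.atTop_add tendsto_snd))).add (Tendsto.const_mul 2 ?_)
    exact tendsto_const_nhds.div_atTop
      (tendsto_atTop_add_const_right _ _ (hround.comp tendsto_fst))
  rw [sub_self, mul_zero, add_zero] at hlim
  refine squeeze_zero_norm' ?_ hlim
  filter_upwards [(eventually_ge_atTop 1).prod_inl _, hM.prod_inr _,
    (hround.eventually_ge_atTop (|t₀| + 1 + 2)).prod_inl _] with p h1 h2 h3
  exact norm_spiral_add_sub_le h1 h2 h3

end Spiral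

/-! ### The flow on the circle with the spiral -/

section SpiralFlow

theorem homoclinic_mem_spiralSet (u : ℝ) : homoclinic u ∈ spiralSet :=
  Or.inl (mem_sphere_zero_iff_norm.2 (norm_homoclinic u))

theorem spiral_mem_spiralSet (s : ℝ) : spiral s ∈ spiralSet := Or.inr ⟨s, rfl⟩

/-- `𝔖` is the disjoint union of three orbits. -/
theorem spiralSet_cases {z : ℂ} (hz : z ∈ spiralSet) :
    z = 1 ∨ (∃ u, homoclinic u = z) ∨ ∃ s, spiral s = z := by
  rcases hz with hz | ⟨s, rfl⟩
  · by_cases h1 : z = 1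
    · exact Or.inl h1
    · exact Or.inr (Or.inl ⟨_, homoclinic_circleTime (mem_sphere_zero_iff_norm.1 hz) h1⟩)
  · exact Or.inr (Or.inr ⟨s, rfl⟩)

/-- The flow on `𝔖`, as a map of the plane. -/
noncomputable def spiralFlowFun (t : ℝ) (z : ℂ) : ℂ :=
  if ‖z‖ < 1 then spiral (spiralTime z + t) else circleFlow t z

theorem spiralFlowFun_spiral (t s : ℝ) : spiralFlowFun t (spiral s) = spiral (s + t) := by
  rw [spiralFlowFun, if_pos (spiral_norm_lt_one s), spiralTime_spiral]

theorem spiralFlowFun_of_norm_eq_one (t : ℝ) {z : ℂ} (hz : ‖z‖ = 1) :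
    spiralFlowFun t z = circleFlow t z := by
  rw [spiralFlowFun, if_neg (by rw [hz]; exact lt_irrefl _)]

theorem spiralFlowFun_homoclinic (t u : ℝ) :
    spiralFlowFun t (homoclinic u) = homoclinic (u + t) := by
  rw [spiralFlowFun_of_norm_eq_one t (norm_homoclinic u), circleFlow_homoclinic]

theorem spiralFlowFun_one (t : ℝ) : spiralFlowFun t 1 = 1 := by
  rw [spiralFlowFun_of_norm_eq_one t norm_one, circleFlow_one]

theorem spiralFlowFun_mem (t : ℝ) {z : ℂ} (hz : z ∈ spiralSet) : spiralFlowFun t z ∈ spiralSet := by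
  rcases spiralSet_cases hz with rfl | ⟨u, rfl⟩ | ⟨s, rfl⟩
  · rwa [spiralFlowFun_one]
  · rw [spiralFlowFun_homoclinic]
    exact homoclinic_mem_spiralSet _
  · rw [spiralFlowFun_spiral]
    exact spiral_mem_spiralSet _

theorem norm_pos_of_mem_spiralSet {z : ℂ} (hz : z ∈ spiralSet) : 0 < ‖z‖ := by
  rcases hz with hz | ⟨s, rfl⟩
  · rw [mem_sphere_zero_iff_norm.1 hz]
    exact one_pos
  · rw [norm_spiral]
    exact spiralRadius_pos s

theorem tendsto_spiralTime_range {z₀ : ℂ} (hz₀ : ‖z₀‖ = 1) :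
    Tendsto spiralTime (𝓝[Set.range spiral] z₀) atTop := by
  refine (tendsto_spiralTime_atTop hz₀).mono_left (nhdsWithin_mono _ ?_)
  rintro _ ⟨s, rfl⟩
  exact spiral_norm_lt_one s

/-- Near the circle, a point of the spiral at time `s` is close to the point
`homoclinic (spiralOffset s)` of the circle. -/
theorem tendsto_homoclinic_offset {z₀ : ℂ} (hz₀ : ‖z₀‖ = 1) :
    Tendsto (fun z => homoclinic (spiralOffset (spiralTime z))) (𝓝[Set.range spiral] z₀)
      (𝓝[Metric.sphere 0 1] z₀) := by
  refine tendsto_nhdsWithin_iff.2 ⟨?_, Eventually.of_forall fun z =>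
    mem_sphere_zero_iff_norm.2 (norm_homoclinic _)⟩
  have h1 := (tendsto_spiral_sub_homoclinic 0).comp
    ((tendsto_spiralTime_range hz₀).prodMk tendsto_const_nhds)
  have h2 : Tendsto (fun z : ℂ => z) (𝓝[Set.range spiral] z₀) (𝓝 z₀) :=
    tendsto_id.mono_left nhdsWithin_le_nhds
  have h3 := h2.sub h1
  rw [sub_zero] at h3
  refine h3.congr' ?_
  filter_upwards [self_mem_nhdsWithin] with z hz
  obtain ⟨s, rfl⟩ := hz
  simp [spiralTime_spiral]

theorem continuousOn_spiralFlowFun :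
    ContinuousOn (Function.uncurry spiralFlowFun) (Set.univ ×ˢ spiralSet) := by
  rintro ⟨t₀, z₀⟩ ⟨-, hz₀ : z₀ ∈ spiralSet⟩
  by_cases hlt : ‖z₀‖ < 1
  · have hopen : IsOpen {z : ℂ | 0 < ‖z‖ ∧ ‖z‖ < 1} :=
      (isOpen_lt continuous_const continuous_norm).inter (isOpen_lt continuous_norm continuous_const)
    have h1 : ContinuousAt spiralTime z₀ :=
      continuousOn_spiralTime.continuousAt (hopen.mem_nhds ⟨norm_pos_of_mem_spiralSet hz₀, hlt⟩)
    have h2 : ContinuousAt (fun p : ℝ × ℂ => spiral (spiralTime p.2 + p.1)) (t₀, z₀) :=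
      continuous_spiral.continuousAt.comp
        ((ContinuousAt.comp (f := (Prod.snd : ℝ × ℂ → ℂ)) (x := (t₀, z₀)) h1
          continuousAt_snd).add continuousAt_fst)
    refine (h2.congr ?_).continuousWithinAt
    have h3 : ∀ᶠ p : ℝ × ℂ in 𝓝 (t₀, z₀), ‖p.2‖ < 1 :=
      (continuous_norm.comp continuous_snd).continuousAt.eventually (gt_mem_nhds hlt)
    filter_upwards [h3] with p hp
    exact (if_pos hp).symm
  · have hz1 : ‖z₀‖ = 1 := by
      rcases hz₀ with h | ⟨s, rfl⟩
      · exact mem_sphere_zero_iff_norm.1 h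
      · exact absurd (spiral_norm_lt_one s) hlt
    rw [spiralSet, Set.prod_union]
    refine ContinuousWithinAt.union ?_ ?_
    · refine (continuousOn_circleFlow (t₀, z₀) ⟨trivial, mem_sphere_zero_iff_norm.2 hz1⟩).congr
        (fun p hp => ?_) (spiralFlowFun_of_norm_eq_one t₀ hz1)
      exact spiralFlowFun_of_norm_eq_one p.1 (mem_sphere_zero_iff_norm.1 hp.2)
    · rw [ContinuousWithinAt, nhdsWithin_prod_eq, nhdsWithin_univ, Function.uncurry_apply_pair,
        spiralFlowFun_of_norm_eq_one t₀ hz1]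
      have h1 := (tendsto_spiral_sub_homoclinic t₀).comp
        (((tendsto_spiralTime_range hz1).comp tendsto_snd).prodMk (tendsto_fst (f := 𝓝 t₀)))
      have h2 : Tendsto (fun p : ℝ × ℂ => circleFlow p.1 (homoclinic
          (spiralOffset (spiralTime p.2)))) (𝓝 t₀ ×ˢ 𝓝[Set.range spiral] z₀)
          (𝓝 (circleFlow t₀ z₀)) := by
        have h3 := continuousOn_circleFlow (t₀, z₀) ⟨trivial, mem_sphere_zero_iff_norm.2 hz1⟩
        rw [ContinuousWithinAt, nhdsWithin_prod_eq, nhdsWithin_univ] at h3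
        exact h3.comp (tendsto_fst.prodMk ((tendsto_homoclinic_offset hz1).comp tendsto_snd))
      have h4 := h1.add h2
      rw [zero_add] at h4
      refine h4.congr' ?_
      filter_upwards [(eventually_mem_nhdsWithin (a := z₀) (s := Set.range spiral)).prod_inr
        (𝓝 t₀)] with p hp
      simp only [Function.comp_apply]
      rw [circleFlow_homoclinic, sub_add_cancel, Function.uncurry, spiralFlowFun, if_pos]
      obtain ⟨s, hs⟩ := hp
      rw [← hs]
      exact spiral_norm_lt_one s

/-- The flow on `𝔖`: it moves the points of the spiral and of the circle without `1` along the
parametrizations `spiral` and `homoclinic`, and fixes `1`. -/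
noncomputable def spiralFlow : Flow ℝ spiralSet where
  toFun t z := ⟨spiralFlowFun t z, spiralFlowFun_mem t z.2⟩
  cont' := by
    refine Continuous.subtype_mk ?_ _
    have h : Continuous fun p : ℝ × spiralSet => (p.1, (p.2 : ℂ)) := by fun_prop
    exact continuousOn_spiralFlowFun.comp_continuous h fun p => ⟨trivial, p.2.2⟩
  map_add' t₁ t₂ := by
    rintro ⟨z, hz⟩
    refine Subtype.ext ?_
    change spiralFlowFun (t₁ + t₂) z = spiralFlowFun t₁ (spiralFlowFun t₂ z)
    rcases spiralSet_cases hz with rfl | ⟨u, rfl⟩ | ⟨s, rfl⟩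
    · simp only [spiralFlowFun_one]
    · simp only [spiralFlowFun_homoclinic, add_assoc, add_comm t₁]
    · simp only [spiralFlowFun_spiral, add_assoc, add_comm t₁]
  map_zero' := by
    rintro ⟨z, hz⟩
    refine Subtype.ext ?_
    change spiralFlowFun 0 z = z
    rcases spiralSet_cases hz with rfl | ⟨u, rfl⟩ | ⟨s, rfl⟩
    · simp only [spiralFlowFun_one]
    · simp only [spiralFlowFun_homoclinic, add_zero]
    · simp only [spiralFlowFun_spiral, add_zero]

theorem spiralFlow_fixPt (t : ℝ) : spiralFlow t fixPt = fixPt :=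
  Subtype.ext (spiralFlowFun_one t)

theorem homoclinic_zero : homoclinic 0 = -1 := by
  rw [homoclinic_of_nonneg le_rfl]
  simp [Complex.exp_pi_mul_I]

theorem spiralFlow_antiPt (t : ℝ) : (spiralFlow t antiPt : ℂ) = homoclinic t := by
  have h := spiralFlowFun_homoclinic t 0
  rwa [homoclinic_zero, zero_add] at h

theorem spiralFlow_spiralPt (s t : ℝ) : spiralFlow t (spiralPt s) = spiralPt (s + t) :=
  Subtype.ext (spiralFlowFun_spiral t s)

theorem isInvariant_spiralFlow : IsInvariant spiralFlow ({fixPt}ᶜ : Set spiralSet) := by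
  intro t z hz h
  refine hz ?_
  rw [Set.mem_singleton_iff] at h ⊢
  rw [← spiralFlow.map_zero_apply z, ← neg_add_cancel t, spiralFlow.map_add, h, spiralFlow_fixPt]

theorem isLocallyClosed_spiralSet : IsLocallyClosed spiralSet := by
  have hopen : IsOpen {z : ℂ | 0 < ‖z‖ ∧ ‖z‖ < 1} :=
    (isOpen_lt continuous_const continuous_norm).inter (isOpen_lt continuous_norm continuous_const)
  have hc : ContinuousOn (fun z => spiral (spiralTime z) - z) {z : ℂ | 0 < ‖z‖ ∧ ‖z‖ < 1} :=
    (continuous_spiral.comp_continuousOn continuousOn_spiralTime).sub continuousOn_id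
  have hO := (hc.isOpen_inter_preimage hopen (isOpen_compl_singleton (x := (0 : ℂ)))).union
    (isOpen_lt (continuous_const (y := (1 : ℝ))) (continuous_norm (E := ℂ)))
  refine ⟨{0}ᶜ, _, isOpen_compl_singleton, hO.isClosed_compl, ?_⟩
  ext z
  constructor
  · intro hz
    refine ⟨norm_pos_iff.1 (norm_pos_of_mem_spiralSet hz), ?_⟩
    rintro (⟨h1, h2⟩ | h)
    · rcases hz with hz | ⟨s, rfl⟩
      · exact h1.2.ne (mem_sphere_zero_iff_norm.1 hz)
      · exact h2 (by simp [spiralTime_spiral])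
    · rcases hz with hz | ⟨s, rfl⟩
      · exact (ne_of_gt h) (mem_sphere_zero_iff_norm.1 hz)
      · exact (lt_asymm h) (spiral_norm_lt_one s)
  · rintro ⟨h0, h⟩
    rcases lt_trichotomy ‖z‖ 1 with h1 | h1 | h1
    · refine Or.inr ⟨spiralTime z, ?_⟩
      by_contra hne
      exact h (Or.inl ⟨⟨norm_pos_iff.2 h0, h1⟩, fun h' => hne (sub_eq_zero.1 h')⟩)
    · exact Or.inl (mem_sphere_zero_iff_norm.2 h1)
    · exact absurd (Or.inr h1) h

instance : LocallyCompactSpace spiralSet := isLocallyClosed_spiralSet.locallyCompactSpace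

instance : LocallyCompactSpace PuncturedSpiralSet :=
  (isOpen_compl_singleton (x := fixPt)).locallyCompactSpace

theorem homoclinic_ne_fixPt (u : ℝ) :
    (⟨homoclinic u, homoclinic_mem_spiralSet u⟩ : spiralSet) ∈ ({fixPt}ᶜ : Set spiralSet) :=
  fun h => homoclinic_ne_one u (congrArg Subtype.val (Set.mem_singleton_iff.1 h))

/-- The point `homoclinic u` of `𝔖 ∖ {1}`. -/
noncomputable def circlePt' (u : ℝ) : PuncturedSpiralSet :=
  ⟨⟨homoclinic u, homoclinic_mem_spiralSet u⟩, homoclinic_ne_fixPt u⟩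

theorem puncturedSpiralSet_cases (y : PuncturedSpiralSet) :
    (∃ u, circlePt' u = y) ∨ ∃ s, spiralPt' s = y := by
  rcases spiralSet_cases y.1.2 with h | ⟨u, hu⟩ | ⟨s, hs⟩
  · exact absurd (Subtype.ext h) y.2
  · exact Or.inl ⟨u, Subtype.ext (Subtype.ext hu)⟩
  · exact Or.inr ⟨s, Subtype.ext (Subtype.ext hs)⟩

theorem continuous_circlePt' : Continuous circlePt' :=
  (continuous_homoclinic.subtype_mk _).subtype_mk _

theorem continuous_spiralPt' : Continuous spiralPt' :=
  (continuous_spiral.subtype_mk _).subtype_mk _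

/-- The flow on `𝔖 ∖ {1}`. -/
noncomputable abbrev puncturedFlow : Flow ℝ PuncturedSpiralSet :=
  spiralFlow.restrict isInvariant_spiralFlow

theorem puncturedFlow_circlePt' (t u : ℝ) : puncturedFlow t (circlePt' u) = circlePt' (u + t) :=
  Subtype.ext (Subtype.ext (spiralFlowFun_homoclinic t u))

theorem puncturedFlow_spiralPt' (t s : ℝ) : puncturedFlow t (spiralPt' s) = spiralPt' (s + t) :=
  Subtype.ext (Subtype.ext (spiralFlowFun_spiral t s))

end SpiralFlow

/-! ### Weak limits of the orbits -/

section WeakLimits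

open ZeroAtInftyContinuousMap

/-- A function in `C₀` of a punctured Hausdorff space extends continuously by zero. -/
theorem exists_continuous_extension {X : Type*} [TopologicalSpace X] [T2Space X] {a : X}
    (f : C₀(↥({a}ᶜ : Set X), ℂ)) :
    ∃ F : X → ℂ, Continuous F ∧ F a = 0 ∧ ∀ y : ↥({a}ᶜ : Set X), F y = f y := by
  classical
  set F : X → ℂ := fun x => if h : x = a then 0 else f ⟨x, h⟩ with hF
  have hFa : F a = 0 := dif_pos rfl
  have hFy : ∀ y : ↥({a}ᶜ : Set X), F y = f y := fun y => dif_neg y.2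
  refine ⟨F, continuous_iff_continuousAt.2 fun x => ?_, hFa, hFy⟩
  by_cases hx : x = a
  · subst hx
    rw [ContinuousAt, hFa, Metric.tendsto_nhds]
    intro ε hε
    have hK := (f.isCompact_norm_ge hε).image continuous_subtype_val
    filter_upwards [hK.isClosed.isOpen_compl.mem_nhds fun ⟨y, _, hy⟩ => y.2 hy] with z hz
    rw [dist_zero_right]
    by_cases hzx : z = x
    · rw [hzx, hFa, norm_zero]
      exact hε
    · by_contra hlt
      refine hz ⟨⟨z, hzx⟩, ?_, rfl⟩
      rw [Set.mem_ofPred_eq, ← hFy]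
      exact not_lt.1 hlt
  · have h := (isOpen_compl_singleton (x := a)).isOpenEmbedding_subtypeVal.continuousAt_iff
      (g := F) (x := ⟨x, hx⟩)
    refine h.1 ?_
    have : F ∘ Subtype.val = f := funext hFy
    rw [this]
    exact f.continuous.continuousAt

variable (f : C₀(PuncturedSpiralSet, ℂ))

theorem tendsto_apply_circlePt' : Tendsto (fun u => f (circlePt' u)) (cocompact ℝ) (𝓝 0) := by
  obtain ⟨F, hF, h1, hFy⟩ := exists_continuous_extension f
  have h : Tendsto (fun u => (circlePt' u).1) (cocompact ℝ) (𝓝 fixPt) :=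
    tendsto_subtype_rng.2 tendsto_homoclinic_cocompact
  have h2 := (hF.tendsto fixPt).comp h
  rw [h1] at h2
  exact h2.congr fun u => hFy _

/-- As `t → ∞`, the values of `f` at the point `γ(s + t)` and at the point of the circle that
follows it have the same asymptotics. This rests on the compactness of the circle. -/
theorem tendsto_apply_spiralPt'_sub (s : ℝ) :
    Tendsto (fun t => f (spiralPt' (s + t)) - f (circlePt' (s + spiralOffset t))) atTop (𝓝 0) := by
  obtain ⟨F, hF, h1, hFy⟩ := exists_continuous_extension f
  rw [tendsto_iff_ultrafilter]
  intro U hU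
  have hsph : IsCompact (Metric.sphere (0 : ℂ) 1) := isCompact_sphere _ _
  obtain ⟨z, hz, hlim⟩ := hsph.ultrafilter_le_nhds
    (U.map fun t => homoclinic (s + spiralOffset t)) (by
      rw [le_principal_iff, Ultrafilter.coe_map, mem_map]
      exact univ_mem' fun t => mem_sphere_zero_iff_norm.2 (norm_homoclinic _))
  have hy : Tendsto (fun t => homoclinic (s + spiralOffset t)) U (𝓝 z) := hlim
  have hd := ((tendsto_spiral_sub_homoclinic s).comp
    (tendsto_id.prodMk (tendsto_const_nhds (x := s)))).mono_left hU
  have hx : Tendsto (fun t => spiral (s + t)) U (𝓝 z) := by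
    have h := hd.add hy
    rw [zero_add] at h
    refine h.congr fun t => ?_
    simp only [Function.comp_apply, id]
    rw [add_comm t, add_comm (spiralOffset t), sub_add_cancel]
  have hzS : z ∈ spiralSet := Or.inl hz
  have hy' : Tendsto (fun t => (circlePt' (s + spiralOffset t)).1) U (𝓝 ⟨z, hzS⟩) :=
    tendsto_subtype_rng.2 hy
  have hx' : Tendsto (fun t => (spiralPt' (s + t)).1) U (𝓝 ⟨z, hzS⟩) :=
    tendsto_subtype_rng.2 hx
  have h := ((hF.tendsto _).comp hx').sub ((hF.tendsto _).comp hy')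
  rw [sub_self] at h
  refine h.congr fun t => ?_
  simp only [Function.comp_apply, hFy]

/-- The function on `𝔖 ∖ {1}` that vanishes on the circle and copies the values of `f` on the circle
to the spiral, matching the parametrizations `homoclinic` and `spiral`. The weak limits of the
orbit of `f` are `0` and the images of the translates of `f` under this map. -/
noncomputable def circleToSpiral : C₀(PuncturedSpiralSet, ℂ) where
  toFun y := if ‖((y : spiralSet) : ℂ)‖ < 1 then f (circlePt' (spiralTime y)) else 0
  continuous_toFun := by
    refine continuous_iff_continuousAt.2 fun y => ?_
    have hval : Continuous fun y : PuncturedSpiralSet => ((y : spiralSet) : ℂ) := by fun_prop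
    have hev : ContinuousAt (fun y : PuncturedSpiralSet => ‖((y : spiralSet) : ℂ)‖) y :=
      hval.norm.continuousAt
    by_cases hy : ‖((y : spiralSet) : ℂ)‖ < 1
    · have hopen : IsOpen {z : ℂ | 0 < ‖z‖ ∧ ‖z‖ < 1} :=
        (isOpen_lt continuous_const continuous_norm).inter
          (isOpen_lt continuous_norm continuous_const)
      have h1 : ContinuousAt spiralTime y := continuousOn_spiralTime.continuousAt
        (hopen.mem_nhds ⟨norm_pos_of_mem_spiralSet y.1.2, hy⟩)
      have h2 : ContinuousAt (fun y : PuncturedSpiralSet => f (circlePt' (spiralTime y))) y :=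
        (f.continuous.comp continuous_circlePt').continuousAt.comp
          (ContinuousAt.comp (f := fun y : PuncturedSpiralSet => ((y : spiralSet) : ℂ)) h1
            hval.continuousAt)
      refine h2.congr ?_
      filter_upwards [hev.eventually (gt_mem_nhds hy)] with z hz
      rw [if_pos hz]
    · have hy1 : ‖((y : spiralSet) : ℂ)‖ = 1 := by
        rcases y.1.2 with h | ⟨s, hs⟩
        · exact mem_sphere_zero_iff_norm.1 h
        · exact absurd (hs ▸ spiral_norm_lt_one s) hy
      rw [ContinuousAt, if_neg hy, Metric.tendsto_nhds]
      intro ε hε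
      -- near the circle the spiral is at a late time, where the copied values are small
      have h3 : ∀ᶠ z in 𝓝[{z : ℂ | ‖z‖ < 1}] ((y : spiralSet) : ℂ),
          ‖f (circlePt' (spiralTime z))‖ < ε := by
        have := ((tendsto_apply_circlePt' f).mono_left atTop_le_cocompact).comp
          (tendsto_spiralTime_atTop hy1)
        simpa [dist_zero_right] using Metric.tendsto_nhds.1 this ε hε
      filter_upwards [hval.continuousAt.eventually (eventually_nhdsWithin_iff.1 h3)] with z hz
      rw [dist_zero_right]
      split_ifs with h
      · exact hz h
      · simpa using hε
  zero_at_infty' := by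
    rw [Metric.tendsto_nhds]
    intro ε hε
    obtain ⟨K, hK, hKs⟩ := mem_cocompact.1 (Metric.tendsto_nhds.1 (tendsto_apply_circlePt' f) ε hε)
    refine mem_cocompact.2 ⟨_, hK.image continuous_spiralPt', fun y hy => ?_⟩
    change dist _ 0 < ε
    rw [dist_zero_right]
    split_ifs with h
    · rcases y.1.2 with h1 | ⟨s, hs⟩
      · exact absurd h (by rw [mem_sphere_zero_iff_norm.1 h1]; exact lt_irrefl _)
      · rw [← hs, spiralTime_spiral]
        have : s ∉ K := fun hsK => hy ⟨s, hsK, Subtype.ext (Subtype.ext hs)⟩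
        simpa [dist_zero_right] using hKs this
    · simpa using hε

theorem circleToSpiral_spiralPt' (s : ℝ) : circleToSpiral f (spiralPt' s) = f (circlePt' s) := by
  change (if ‖spiral s‖ < 1 then f (circlePt' (spiralTime (spiral s))) else 0) = _
  rw [if_pos (spiral_norm_lt_one s), spiralTime_spiral]

theorem circleToSpiral_circlePt' (u : ℝ) : circleToSpiral f (circlePt' u) = 0 := by
  refine if_neg ?_
  change ¬ ‖homoclinic u‖ < 1
  rw [norm_homoclinic]
  exact lt_irrefl _

theorem norm_circleToSpiral_le : ‖circleToSpiral f‖ ≤ ‖f‖ := by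
  refine norm_le_of_forall (norm_nonneg _) fun y => ?_
  rcases puncturedSpiralSet_cases y with ⟨u, rfl⟩ | ⟨s, rfl⟩
  · rw [circleToSpiral_circlePt', norm_zero]
    exact norm_nonneg _
  · rw [circleToSpiral_spiralPt']
    exact f.norm_apply_le _

theorem circleToSpiral_sub (g : C₀(PuncturedSpiralSet, ℂ)) :
    circleToSpiral (f - g) = circleToSpiral f - circleToSpiral g := by
  ext y
  rcases puncturedSpiralSet_cases y with ⟨u, rfl⟩ | ⟨s, rfl⟩
  · simp [circleToSpiral_circlePt']
  · simp [circleToSpiral_spiralPt']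

theorem continuous_circleToSpiral : Continuous circleToSpiral :=
  LipschitzWith.continuous (K := 1) (LipschitzWith.of_dist_le_mul fun f g => by
    rw [dist_eq_norm, dist_eq_norm, ← circleToSpiral_sub, NNReal.coe_one, one_mul]
    exact norm_circleToSpiral_le _)

/-- The weak limit of `f ∘ φ_t` along times `t → ∞` with `spiralOffset t → v`. -/
noncomputable def orbitLimit (v : ℝ) : C₀(PuncturedSpiralSet, ℂ) :=
  circleToSpiral (koopman puncturedFlow v f)

theorem orbitLimit_spiralPt' (v s : ℝ) : orbitLimit f v (spiralPt' s) = f (circlePt' (s + v)) := by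
  rw [orbitLimit, circleToSpiral_spiralPt', koopman_apply, puncturedFlow_circlePt']

theorem orbitLimit_circlePt' (v u : ℝ) : orbitLimit f v (circlePt' u) = 0 :=
  circleToSpiral_circlePt' _ u

theorem norm_orbitLimit_le (v : ℝ) : ‖orbitLimit f v‖ ≤ ‖f‖ :=
  (norm_circleToSpiral_le _).trans (norm_koopman_apply_le _ _ _)

theorem continuous_orbitLimit : Continuous (orbitLimit f) :=
  continuous_circleToSpiral.comp (continuous_koopman puncturedFlow f)

theorem tendsto_orbitLimit_cocompact :
    Tendsto (fun v => toWeakSpace ℂ C₀(PuncturedSpiralSet, ℂ) (orbitLimit f v)) (cocompact ℝ)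
      (𝓝 0) := by
  have : (cocompact ℝ).IsCountablyGenerated := by
    rw [cocompact_eq_atBot_atTop]
    infer_instance
  refine tendsto_toWeakSpace_zero (norm_orbitLimit_le f) fun y => ?_
  rcases puncturedSpiralSet_cases y with ⟨u, rfl⟩ | ⟨s, rfl⟩
  · simp only [orbitLimit_circlePt', tendsto_const_nhds]
  · simp only [orbitLimit_spiralPt']
    exact (tendsto_apply_circlePt' f).comp
      (Homeomorph.addLeft s).isClosedEmbedding.tendsto_cocompact

theorem tendsto_koopman_sub_orbitLimit :
    Tendsto (fun t => toWeakSpace ℂ C₀(PuncturedSpiralSet, ℂ)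
      (koopman puncturedFlow t f - orbitLimit f (spiralOffset t))) atTop (𝓝 0) := by
  refine tendsto_toWeakSpace_zero (C := ‖f‖ + ‖f‖) (fun t => (norm_sub_le _ _).trans
    (add_le_add (norm_koopman_apply_le _ _ _) (norm_orbitLimit_le f _))) fun y => ?_
  rcases puncturedSpiralSet_cases y with ⟨u, rfl⟩ | ⟨s, rfl⟩
  · simp only [ZeroAtInftyContinuousMap.sub_apply, orbitLimit_circlePt', koopman_apply, puncturedFlow_circlePt', sub_zero]
    exact (tendsto_apply_circlePt' f).comp
      ((Homeomorph.addLeft u).isClosedEmbedding.tendsto_cocompact.mono_left atTop_le_cocompact)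
  · simp only [ZeroAtInftyContinuousMap.sub_apply, orbitLimit_spiralPt', koopman_apply, puncturedFlow_spiralPt']
    exact tendsto_apply_spiralPt'_sub f s

theorem tendsto_koopman_of_offset {ι : Type*} {l : Filter ι} {t : ι → ℝ}
    {a : WeakSpace ℂ C₀(PuncturedSpiralSet, ℂ)} (ht : Tendsto t l atTop)
    (ha : Tendsto (fun i => toWeakSpace ℂ C₀(PuncturedSpiralSet, ℂ)
      (orbitLimit f (spiralOffset (t i)))) l (𝓝 a)) :
    Tendsto (fun i => toWeakSpace ℂ C₀(PuncturedSpiralSet, ℂ) (koopman puncturedFlow (t i) f)) l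
      (𝓝 a) := by
  have h := ((tendsto_koopman_sub_orbitLimit f).comp ht).add ha
  rw [zero_add] at h
  refine h.congr fun i => ?_
  rw [Function.comp_apply, ← map_add, sub_add_cancel]

/-- An ultrafilter on a space either converges or escapes to infinity. -/
theorem Ultrafilter.le_nhds_or_le_cocompact {X : Type*} [TopologicalSpace X] (U : Ultrafilter X) :
    (∃ x, (U : Filter X) ≤ 𝓝 x) ∨ (U : Filter X) ≤ cocompact X := by
  by_cases h : ∃ K, IsCompact K ∧ K ∈ U
  · obtain ⟨K, hK, hKU⟩ := h
    obtain ⟨x, -, hx⟩ := hK.ultrafilter_le_nhds U (le_principal_iff.2 hKU)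
    exact Or.inl ⟨x, hx⟩
  · refine Or.inr fun s hs => ?_
    obtain ⟨K, hK, hKs⟩ := mem_cocompact.1 hs
    exact mem_of_superset (Ultrafilter.compl_mem_iff_notMem.2 fun hKU => h ⟨K, hK, hKU⟩) hKs

/-- The weak limit points of the orbit of `f`, together with the orbit, form a weakly compact set. -/
theorem isCompact_closure_koopman_orbit :
    IsCompact (closure ((fun t => toWeakSpace ℂ C₀(PuncturedSpiralSet, ℂ)
      (koopman puncturedFlow t f)) '' Set.Ici (0 : ℝ))) := by
  set g := fun t => toWeakSpace ℂ C₀(PuncturedSpiralSet, ℂ) (koopman puncturedFlow t f) with hg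
  set w := fun v => toWeakSpace ℂ C₀(PuncturedSpiralSet, ℂ) (orbitLimit f v) with hw
  have hgc : Continuous g :=
    (toWeakSpaceCLM ℂ C₀(PuncturedSpiralSet, ℂ)).continuous.comp (continuous_koopman _ f)
  have hwc : Continuous w :=
    (toWeakSpaceCLM ℂ C₀(PuncturedSpiralSet, ℂ)).continuous.comp (continuous_orbitLimit f)
  set E := g '' Set.Ici 0 ∪ insert 0 (Set.range w) with hE
  have hwlim : ∀ V : Ultrafilter ℝ, ∃ a ∈ insert 0 (Set.range w), Tendsto w V (𝓝 a) := by
    intro V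
    rcases V.le_nhds_or_le_cocompact with ⟨v, hv⟩ | hv
    · exact ⟨w v, Or.inr ⟨v, rfl⟩, (hwc.tendsto v).mono_left hv⟩
    · exact ⟨0, Or.inl rfl, (tendsto_orbitLimit_cocompact f).mono_left hv⟩
  have hcomp : IsCompact E := by
    refine isCompact_iff_ultrafilter_le_nhds.2 fun U hU => ?_
    rw [le_principal_iff, Ultrafilter.mem_coe, hE, Ultrafilter.union_mem_iff] at hU
    rcases hU with hU | hU
    · set V := Ultrafilter.ofComapInfPrincipal hU
      have hVA : Set.Ici (0 : ℝ) ∈ V := Ultrafilter.ofComapInfPrincipal_mem hU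
      have hVU : V.map g = U := Ultrafilter.ofComapInfPrincipal_eq_of_map hU
      have hVg : ∀ a, Tendsto g V (𝓝 a) → (U : Filter _) ≤ 𝓝 a := fun a ha => by
        rw [← hVU]
        exact ha
      rcases V.le_nhds_or_le_cocompact with ⟨t, ht⟩ | hVc
      · have ht0 : t ∈ Set.Ici (0 : ℝ) := isClosed_Ici.mem_of_frequently_of_tendsto
          (Eventually.frequently (f := (V : Filter ℝ)) hVA) (tendsto_id.mono_left ht)
        exact ⟨g t, Or.inl ⟨t, ht0, rfl⟩, hVg _ ((hgc.tendsto t).mono_left ht)⟩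
      · have hVtop : Tendsto id (V : Filter ℝ) atTop := by
          refine tendsto_atTop.2 fun b => ?_
          filter_upwards [hVA, hVc (isCompact_Icc (a := 0) (b := b)).compl_mem_cocompact]
            with t h0 hb
          by_contra hlt
          exact hb ⟨h0, (not_le.1 hlt).le⟩
        obtain ⟨a, haE, ha⟩ := hwlim (V.map spiralOffset)
        exact ⟨a, Or.inr haE, hVg a (tendsto_koopman_of_offset f hVtop ha)⟩
    · rw [Set.insert_eq, Ultrafilter.union_mem_iff] at hU
      rcases hU with hU | hU
      · refine ⟨0, Or.inr (Or.inl rfl), ?_⟩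
        exact (le_principal_iff.2 hU).trans (by simp)
      · rw [← Set.image_univ] at hU
        obtain ⟨a, haE, ha⟩ := hwlim (Ultrafilter.ofComapInfPrincipal hU)
        refine ⟨a, Or.inr haE, ?_⟩
        rw [← Ultrafilter.ofComapInfPrincipal_eq_of_map hU]
        exact ha
  exact hcomp.closure_of_subset Set.subset_union_left

end WeakLimits

/-! ### Almost weak stability -/

section Density

theorem infinite_of_tendsto_count {p : ℕ → Prop} [DecidablePred p]
    (h : Tendsto (fun N : ℕ => (Nat.count p (N + 1) : ℝ) / N) atTop (𝓝 1)) :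
    (Set.ofPred p).Infinite := by
  intro hfin
  have h0 : Tendsto (fun N : ℕ => (Nat.count p (N + 1) : ℝ) / N) atTop (𝓝 0) := by
    refine squeeze_zero (fun N => by positivity) (fun N => ?_)
      (tendsto_const_div_atTop_nhds_zero_nat (hfin.toFinset.card : ℝ))
    refine div_le_div_of_nonneg_right ?_ (by positivity)
    rw [Nat.count_eq_card_filter_range]
    exact_mod_cast Finset.card_le_card fun n hn => hfin.mem_toFinset.2 (Finset.mem_filter.1 hn).2
  exact zero_ne_one (tendsto_nhds_unique h0 h)

/-- The increasing enumeration of a set of natural numbers has the density of the set. -/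
theorem hasSeqDensity_nth {p : ℕ → Prop} [DecidablePred p] (hp : (Set.ofPred p).Infinite) {d : ℝ}
    (h : Tendsto (fun N : ℕ => (Nat.count p (N + 1) : ℝ) / N) atTop (𝓝 d)) :
    HasSeqDensity (Nat.nth p) d := by
  refine h.congr fun N => ?_
  have : {k | Nat.nth p k ≤ N} = Set.Iio (Nat.count p (N + 1)) := by
    ext k
    rw [Set.mem_ofPred_eq, Set.mem_Iio, ← Nat.lt_succ_iff, Nat.succ_eq_add_one]
    exact (Nat.lt_nth_iff_count_lt hp).symm
  rw [this, ← Finset.coe_Iio, Set.ncard_coe_finset, Nat.card_Iio]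

/-- The positive integers whose distance in time from the passage of the spiral through the negative
real axis in their round is at least `n ^ (1/4)`, up to rounding. -/
def IsFarTime (n : ℕ) : Prop := 0 < n ∧ (n.sqrt.sqrt : ℝ) ≤ |spiralOffset n|

/-- A natural number `n ≤ N` that is not a far time is determined by its round, of which there are
about `√N`, and by its offset in the round, for which there are about `2 N ^ (1/4)` choices. -/
theorem card_not_isFarTime_le [DecidablePred IsFarTime] (N : ℕ) :
    ((Finset.Icc 1 N).filter fun n => ¬ IsFarTime n).card ≤ (N.sqrt + 1) * (2 * N.sqrt.sqrt) := by
  have hcard : ((Finset.Icc (1 : ℤ) (N.sqrt + 1)) ×ˢ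
      (Finset.Ico (-(N.sqrt.sqrt : ℤ)) N.sqrt.sqrt)).card = (N.sqrt + 1) * (2 * N.sqrt.sqrt) := by
    rw [Finset.card_product, Int.card_Icc, Int.card_Ico]
    congr 1
    · omega
    · omega
  rw [← hcard]
  refine Finset.card_le_card_of_injOn
    (fun n => (spiralRound n, (n : ℤ) - (2 * spiralRound n ^ 2 + 1))) ?_ ?_
  · intro n hn
    simp only [Finset.coe_filter, Finset.mem_Icc, Set.mem_ofPred_eq, IsFarTime, not_and,
      not_le] at hn
    obtain ⟨⟨h1, hN⟩, hfar⟩ := hn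
    have hfar := hfar h1
    obtain ⟨hk, hl, -⟩ := spiralRound_spec (t := n) (by exact_mod_cast h1)
    have hq : n.sqrt.sqrt ≤ N.sqrt.sqrt := Nat.sqrt_le_sqrt (Nat.sqrt_le_sqrt hN)
    rw [spiralOffset] at hfar
    simp only [Finset.coe_product, Finset.coe_Icc, Finset.coe_Ico, Set.mem_prod, Set.mem_Icc,
      Set.mem_Ico]
    set k := spiralRound n
    refine ⟨⟨hk, ?_⟩, ?_, ?_⟩
    · have hl' : 2 * k ^ 2 - 3 * k + 2 ≤ (n : ℤ) := by exact_mod_cast hl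
      have h2 : ((k - 1).toNat) ≤ N.sqrt := by
        rw [Nat.le_sqrt']
        zify
        rw [Int.toNat_of_nonneg (by omega)]
        have : (n : ℤ) ≤ N := by exact_mod_cast hN
        nlinarith
      omega
    all_goals
      have hfar' : |(n : ℤ) - (2 * k ^ 2 + 1)| < (n.sqrt.sqrt : ℤ) := by exact_mod_cast hfar
      rw [abs_lt] at hfar'
      omega
  · intro n _ m _ h
    simp only [Prod.mk.injEq] at h
    obtain ⟨h1, h2⟩ := h
    rw [h1] at h2
    omega

theorem le_count_isFarTime [DecidablePred IsFarTime] (N : ℕ) :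
    N ≤ Nat.count IsFarTime (N + 1) + (N.sqrt + 1) * (2 * N.sqrt.sqrt) := by
  have h1 := Finset.card_filter_add_card_filter_not (s := Finset.Icc 1 N) IsFarTime
  have h2 := card_not_isFarTime_le N
  have h3 : ((Finset.Icc 1 N).filter IsFarTime).card ≤ Nat.count IsFarTime (N + 1) := by
    rw [Nat.count_eq_card_filter_range]
    refine Finset.card_le_card (Finset.filter_subset_filter _ fun n hn => ?_)
    simp only [Finset.mem_Icc, Finset.mem_range] at hn ⊢
    omega
  rw [Nat.card_Icc] at h1
  omega

theorem count_isFarTime_le [DecidablePred IsFarTime] (N : ℕ) :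
    Nat.count IsFarTime (N + 1) ≤ N := by
  rw [Nat.count_succ', if_neg fun h => lt_irrefl _ h.1, add_zero]
  exact Nat.count_le _

theorem tendsto_sqrt_atTop : Tendsto Nat.sqrt atTop atTop :=
  tendsto_atTop.2 fun b => (eventually_ge_atTop (b * b)).mono fun _ h => Nat.le_sqrt.2 h

theorem tendsto_count_isFarTime [DecidablePred IsFarTime] :
    Tendsto (fun N : ℕ => (Nat.count IsFarTime (N + 1) : ℝ) / N) atTop (𝓝 1) := by
  have hq : Tendsto (fun N : ℕ => (N.sqrt.sqrt : ℝ)) atTop atTop :=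
    tendsto_natCast_atTop_atTop.comp (tendsto_sqrt_atTop.comp tendsto_sqrt_atTop)
  have hlow : Tendsto (fun N : ℕ => 1 - 4 / (N.sqrt.sqrt : ℝ)) atTop (𝓝 (1 - 0)) :=
    tendsto_const_nhds.sub (tendsto_const_nhds.div_atTop hq)
  rw [sub_zero] at hlow
  refine tendsto_of_tendsto_of_tendsto_of_le_of_le' hlow tendsto_const_nhds ?_ ?_
  · filter_upwards [hq.eventually_ge_atTop 1] with N hN
    have h1 : (N : ℝ) ≤ Nat.count IsFarTime (N + 1) + (N.sqrt + 1) * (2 * N.sqrt.sqrt) := by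
      exact_mod_cast le_count_isFarTime N
    have h2 : (N.sqrt : ℝ) * N.sqrt ≤ N := by exact_mod_cast Nat.sqrt_le N
    have h3 : (N.sqrt.sqrt : ℝ) * N.sqrt.sqrt ≤ N.sqrt := by exact_mod_cast Nat.sqrt_le _
    set q : ℝ := (N.sqrt.sqrt : ℝ)
    set m : ℝ := (N.sqrt : ℝ)
    have hm : 1 ≤ m := by nlinarith
    have hN0 : (0 : ℝ) < N := by nlinarith
    rw [le_div_iff₀ hN0, sub_mul, one_mul, div_mul_eq_mul_div]
    have h4 : (m + 1) * (2 * q) ≤ 4 * N / q := by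
      rw [le_div_iff₀ (by linarith)]
      nlinarith [mul_nonneg (by linarith : 0 ≤ m) (sub_nonneg.2 h3)]
    linarith
  · filter_upwards with N
    exact div_le_one_of_le₀ (by exact_mod_cast count_isFarTime_le N) (by positivity)

end Density

section Stability

open ZeroAtInftyContinuousMap

theorem almostWeaklyStable_koopman : AlmostWeaklyStable (koopman puncturedFlow 1) := by
  classical
  intro f
  have hinf := infinite_of_tendsto_count tendsto_count_isFarTime
  have hmem : ∀ k, IsFarTime (Nat.nth IsFarTime k) := fun k => Nat.nth_mem_of_infinite hinf k
  have hmono := Nat.nth_strictMono hinf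
  refine ⟨Nat.nth IsFarTime, hmono, fun k => (hmem k).1,
    hasSeqDensity_nth hinf tendsto_count_isFarTime, ?_⟩
  have hoff : Tendsto (fun k => spiralOffset (Nat.nth IsFarTime k)) atTop (cocompact ℝ) := by
    rw [← tendsto_norm_atTop_iff_cocompact]
    refine tendsto_atTop_mono (fun k => (hmem k).2) ?_
    exact tendsto_natCast_atTop_atTop.comp
      (tendsto_sqrt_atTop.comp (tendsto_sqrt_atTop.comp hmono.tendsto_atTop))
  have h := tendsto_koopman_of_offset f
    (tendsto_natCast_atTop_atTop.comp hmono.tendsto_atTop)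
    ((tendsto_orbitLimit_cocompact f).comp hoff)
  refine h.congr fun k => ?_
  simp only [koopman_one_pow, Function.comp_apply]

theorem WeaklyStableSeq.tendsto_functional {X : Type*} [NormedAddCommGroup X] [NormedSpace ℂ X]
    {x : ℕ → X} (hx : WeaklyStableSeq x) (ξ : X →L[ℂ] ℂ) :
    Tendsto (fun n => ξ (x n)) atTop (𝓝 0) := by
  have h : Tendsto (fun n => toWeakSpace ℂ X (x n)) atTop (𝓝 (toWeakSpace ℂ X 0)) := by
    rw [map_zero]
    exact hx
  simpa using tendsto_toWeakSpace_iff.1 h ξ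

/-- A unimodular eigenvector has an orbit of constant modulus at every point, which is incompatible
with weak convergence to `0` along a subsequence. -/
theorem AlmostWeaklyStable.not_hasEigenvalue {Y : Type*} [TopologicalSpace Y]
    {T : C₀(Y, ℂ) →L[ℂ] C₀(Y, ℂ)} (hT : AlmostWeaklyStable T) {μ : ℂ} (hμ : ‖μ‖ = 1) :
    ¬ Module.End.HasEigenvalue (T : C₀(Y, ℂ) →ₗ[ℂ] C₀(Y, ℂ)) μ := by
  intro h
  obtain ⟨f, hf⟩ := h.exists_hasEigenvector
  have hTf : T f = μ • f := hf.apply_eq_smul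
  have hpow : ∀ n : ℕ, (T ^ n) f = μ ^ n • f := fun n => by
    induction n with
    | zero => simp
    | succ n ih => rw [pow_succ, mul_apply_eq_comp, hTf, map_smul, ih, smul_smul, pow_succ']
  refine hf.2 (ZeroAtInftyContinuousMap.ext fun y => ?_)
  obtain ⟨n, -, -, -, hn⟩ := hT f
  have h1 := (hn.tendsto_functional (diracFunctional y)).norm
  have h2 : ∀ k, ‖diracFunctional y ((T ^ n k) f)‖ = ‖f y‖ := fun k => by
    rw [hpow]
    change ‖μ ^ n k * f y‖ = _
    rw [norm_mul, norm_pow, hμ, one_pow, one_mul]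
  simp only [h2, norm_zero] at h1
  exact norm_eq_zero.1 (tendsto_nhds_unique tendsto_const_nhds h1)

/-! ### Times `2n² - 4n + 3` -/

theorem eval_examplePoly (n : ℕ) :
    (examplePoly.eval (n : ℤ)) = 2 * (n : ℤ) ^ 2 - 4 * n + 3 := by
  simp [examplePoly]

theorem mapsPosToNonneg_examplePoly : MapsPosToNonneg examplePoly := fun n _ => by
  rw [eval_examplePoly]
  nlinarith [sq_nonneg ((n : ℤ) - 1)]

theorem natDegree_examplePoly : examplePoly.natDegree = 2 := by
  unfold examplePoly
  compute_degree!

theorem spiralAngle_examplePoly {n : ℕ} (hn : 0 < n) :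
    spiralAngle (2 * (n : ℝ) ^ 2 - 4 * n + 3) = -(2 * (n : ℝ) - 1) * Real.pi := by
  obtain ⟨hA, -, -, -, hE⟩ := spiralAngle_spec
  rcases Nat.lt_or_ge 1 n with h | h
  · have hn2 : (2 : ℝ) ≤ n := by exact_mod_cast h
    have e : 2 * (n : ℝ) ^ 2 - 4 * n + 3 = 2 * (((n : ℤ) - 1 : ℤ) : ℝ) ^ 2 + 1 := by
      push_cast
      ring
    rw [e, hA ((n : ℤ) - 1) (by omega) _ (by push_cast; linarith) le_rfl]
    have e' : 2 * (((n : ℤ) - 1 : ℤ) : ℝ) ^ 2 + 2 - (2 * (((n : ℤ) - 1 : ℤ) : ℝ) ^ 2 + 1) = 1 := by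
      ring
    rw [e']
    push_cast
    ring
  · have : n = 1 := le_antisymm h hn
    subst this
    rw [hE _ (by norm_num)]
    norm_num

theorem tendsto_spiral_examplePoly :
    Tendsto (fun n : ℕ => spiral (2 * (n : ℝ) ^ 2 - 4 * n + 3)) atTop (𝓝 (-1)) := by
  have ht : Tendsto (fun n : ℕ => 2 * (n : ℝ) ^ 2 - 4 * n + 3) atTop atTop := by
    have h1 : Tendsto (fun n : ℕ => (n : ℝ) + -1) atTop atTop :=
      tendsto_atTop_add_const_right _ _ tendsto_natCast_atTop_atTop
    refine tendsto_atTop_mono (fun n => ?_) h1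
    nlinarith [sq_nonneg (4 * (n : ℝ) - 5)]
  have hr : Tendsto (fun n : ℕ => (spiralRadius (2 * (n : ℝ) ^ 2 - 4 * n + 3) : ℂ) * (-1)) atTop
      (𝓝 ((1 : ℝ) * (-1))) :=
    ((Complex.continuous_ofReal.tendsto 1).comp (tendsto_spiralRadius_atTop.comp ht)).mul_const _
  rw [Complex.ofReal_one, one_mul] at hr
  refine hr.congr' ?_
  filter_upwards [eventually_gt_atTop 0] with n hn
  rw [spiral, spiralAngle_examplePoly hn]
  congr 1
  have e : ((-(2 * (n : ℝ) - 1) * Real.pi : ℝ) : ℂ) * Complex.I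
      = Real.pi * Complex.I + ((-n : ℤ) : ℂ) * (2 * Real.pi * Complex.I) := by
    push_cast
    ring
  rw [e, Complex.exp_add, Complex.exp_int_mul_two_pi_mul_I, Complex.exp_pi_mul_I, mul_one]

theorem dirac_polyPow_examplePoly (f : C₀(PuncturedSpiralSet, ℂ)) (n : ℕ) :
    diracFunctional (spiralPt' 0) (polyPow (koopman puncturedFlow 1) examplePoly n f) =
      f (spiralPt' (2 * (n : ℝ) ^ 2 - 4 * n + 3)) := by
  have h : (((examplePoly.eval (n : ℤ)).toNat : ℕ) : ℝ) = 2 * (n : ℝ) ^ 2 - 4 * n + 3 := by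
    have h0 : 0 ≤ examplePoly.eval (n : ℤ) := by
      rw [eval_examplePoly]
      nlinarith [sq_nonneg ((n : ℤ) - 1)]
    have h1 : (((examplePoly.eval (n : ℤ)).toNat : ℤ) : ℝ) = 2 * (n : ℝ) ^ 2 - 4 * n + 3 := by
      rw [Int.toNat_of_nonneg h0, eval_examplePoly]
      push_cast
      ring
    exact_mod_cast h1
  rw [polyPow, koopman_one_pow, h]
  change koopman puncturedFlow _ f (spiralPt' 0) = _
  rw [koopman_apply, puncturedFlow_spiralPt', zero_add]

theorem tendsto_dirac_polyPow (f : C₀(PuncturedSpiralSet, ℂ)) :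
    Tendsto (fun n : ℕ => diracFunctional (spiralPt' 0)
      (polyPow (koopman puncturedFlow 1) examplePoly n f)) atTop (𝓝 (f antiPt')) := by
  simp only [dirac_polyPow_examplePoly]
  have h : Tendsto (fun n : ℕ => spiralPt' (2 * (n : ℝ) ^ 2 - 4 * n + 3)) atTop (𝓝 antiPt') :=
    tendsto_subtype_rng.2 (tendsto_subtype_rng.2 tendsto_spiral_examplePoly)
  exact (f.continuous.tendsto _).comp h

theorem exists_apply_antiPt'_ne_zero : ∃ f : C₀(PuncturedSpiralSet, ℂ), f antiPt' ≠ 0 := by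
  obtain ⟨φ, h1, -, hc, -⟩ := exists_continuous_one_zero_of_isCompact
    (isCompact_singleton (x := antiPt')) isClosed_empty (Set.disjoint_empty _)
  have hc' : HasCompactSupport fun y => (φ y : ℂ) :=
    hc.comp_left (g := ((↑) : ℝ → ℂ)) Complex.ofReal_zero
  refine ⟨⟨⟨fun y => (φ y : ℂ), by fun_prop⟩, hc'.is_zero_at_infty⟩, ?_⟩
  change (φ antiPt' : ℂ) ≠ 0
  rw [h1 rfl]
  simp

theorem not_almostWeaklyStableSeq_polyPow {f : C₀(PuncturedSpiralSet, ℂ)} (hf : f antiPt' ≠ 0) :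
    ¬ AlmostWeaklyStableSeq (fun n => polyPow (koopman puncturedFlow 1) examplePoly n f) := by
  rintro ⟨n, hn, -, -, h⟩
  exact hf (tendsto_nhds_unique ((tendsto_dirac_polyPow f).comp hn.tendsto_atTop)
    (h.tendsto_functional (diracFunctional (spiralPt' 0))))

theorem not_almostWeaklyPolynomialStable_koopman :
    ¬ AlmostWeaklyPolynomialStable (koopman puncturedFlow 1) := fun h => by
  obtain ⟨f, hf⟩ := exists_apply_antiPt'_ne_zero
  exact not_almostWeaklyStableSeq_polyPow hf
    (h examplePoly (by rw [natDegree_examplePoly]; norm_num) mapsPosToNonneg_examplePoly f)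

end Stability

theorem mainTheorem2 :
    (∃ (φ : Flow ℝ spiralSet) (hφ : IsInvariant φ ({fixPt}ᶜ : Set spiralSet))
        (T₀ : ℝ → C₀(PuncturedSpiralSet, ℂ) →L[ℂ] C₀(PuncturedSpiralSet, ℂ)),
      -- the flow on the circle and on the spiral
      (∀ t : ℝ, φ t fixPt = fixPt) ∧
      (∀ t : ℝ, (φ t antiPt : ℂ) = homoclinic t) ∧
      (∀ s t : ℝ, φ t (spiralPt s) = spiralPt (s + t)) ∧
      -- the Koopman semigroup `T₀(t) f = f ∘ φ_t` on `C₀(𝔖 ∖ {1})`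
      (T₀ = koopman (φ.restrict hφ)) ∧
      T₀ 0 = 1 ∧
      (∀ s t : ℝ, 0 ≤ s → 0 ≤ t → T₀ (s + t) = T₀ s * T₀ t) ∧
      -- it is strongly continuous, isometric, and has relatively weakly compact orbits
      (∀ f, ContinuousOn (fun t => T₀ t f) (Set.Ici 0)) ∧
      (∀ t : ℝ, 0 ≤ t → Isometry (T₀ t)) ∧
      (∀ f, IsCompact (closure
        ((fun t => toWeakSpace ℂ C₀(PuncturedSpiralSet, ℂ) (T₀ t f)) '' Set.Ici (0 : ℝ)))) ∧
      -- `T₀(1)` is an almost weakly stable contraction without unimodular eigenvalues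
      ‖T₀ 1‖ ≤ 1 ∧
      (∀ μ : ℂ, ‖μ‖ = 1 → ¬ Module.End.HasEigenvalue
        (T₀ 1 : C₀(PuncturedSpiralSet, ℂ) →ₗ[ℂ] C₀(PuncturedSpiralSet, ℂ)) μ) ∧
      AlmostWeaklyStable (T₀ 1) ∧
      -- its powers along `2n² - 4n + 3`
      (∀ n : ℕ, 0 < n →
        spiralAngle (2 * (n : ℝ) ^ 2 - 4 * n + 3) = -(2 * (n : ℝ) - 1) * Real.pi) ∧
      Tendsto (fun n : ℕ => spiral (2 * (n : ℝ) ^ 2 - 4 * n + 3)) atTop (𝓝 (-1)) ∧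
      (∀ f : C₀(PuncturedSpiralSet, ℂ), ∀ n : ℕ, 0 < n →
        diracFunctional (spiralPt' 0) (polyPow (T₀ 1) examplePoly n f) =
          f (spiralPt' (2 * (n : ℝ) ^ 2 - 4 * n + 3))) ∧
      (∀ f : C₀(PuncturedSpiralSet, ℂ),
        Tendsto (fun n : ℕ => diracFunctional (spiralPt' 0) (polyPow (T₀ 1) examplePoly n f))
          atTop (𝓝 (f antiPt'))) ∧
      (∃ f : C₀(PuncturedSpiralSet, ℂ), f antiPt' ≠ 0) ∧
      (∀ f : C₀(PuncturedSpiralSet, ℂ), f antiPt' ≠ 0 →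
        ¬ WeaklyStableSeq (fun n => polyPow (T₀ 1) examplePoly n f) ∧
        ¬ AlmostWeaklyStableSeq (fun n => polyPow (T₀ 1) examplePoly n f)) ∧
      -- so it is not almost weakly polynomially stable
      0 < examplePoly.natDegree ∧ MapsPosToNonneg examplePoly ∧
      ¬ AlmostWeaklyPolynomialStable (T₀ 1)) ∧
    -- hence almost weak stability of Banach space contractions does not imply the polynomial one
    ¬ (∀ (X : Type) [NormedAddCommGroup X] [NormedSpace ℂ X] [CompleteSpace X]
        (T : X →L[ℂ] X), ‖T‖ ≤ 1 → AlmostWeaklyStable T → AlmostWeaklyPolynomialStable T) := by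
  refine ⟨⟨spiralFlow, isInvariant_spiralFlow, koopman puncturedFlow, spiralFlow_fixPt,
    spiralFlow_antiPt, spiralFlow_spiralPt, rfl, koopman_zero _,
    fun s t _ _ => koopman_add _ s t, fun f => (continuous_koopman _ f).continuousOn,
    fun t _ => isometry_koopman _ t, isCompact_closure_koopman_orbit, norm_koopman_le_one _ 1,
    fun μ hμ => almostWeaklyStable_koopman.not_hasEigenvalue hμ, almostWeaklyStable_koopman,
    fun n hn => spiralAngle_examplePoly hn, tendsto_spiral_examplePoly,
    fun f n _ => dirac_polyPow_examplePoly f n, tendsto_dirac_polyPow,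
    exists_apply_antiPt'_ne_zero, fun f hf => ⟨fun h => hf ?_, ?_⟩, ?_,
    mapsPosToNonneg_examplePoly, not_almostWeaklyPolynomialStable_koopman⟩, fun h => ?_⟩
  · exact tendsto_nhds_unique (tendsto_dirac_polyPow f)
      (h.tendsto_functional (diracFunctional (spiralPt' 0)))
  · exact not_almostWeaklyStableSeq_polyPow hf
  · rw [natDegree_examplePoly]
    norm_num
  · exact not_almostWeaklyPolynomialStable_koopman
      (h _ _ (norm_koopman_le_one _ 1) almostWeaklyStable_koopman)
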